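/- Let $X$ be a compact connected complex manifold of dimension $n\ge 1$ with a Kähler form $\alpha$, and let $\Omega\in H^{1,1}(X,\mathbb R)$ be a cohomology class, i.e. $\Omega=\{\xi_0+\sqrt{-1}\,\partial\bar\partial u : u\in C^\infty(X,\mathbb R)\}$ for a closed smooth real $(1,1)$-form $\xi_0$. For a real $(1,1)$-form $\xi$ let $\lambda_1,\dots,\lambda_n$ be the eigenvalues of $\alpha^{-1}\xi$ and put $\Theta_\alpha(\xi)=\sum_{i}\arctan\lambda_i$; this is the argument of the function $(\alpha+\sqrt{-1}\xi)^n/\alpha^n$, on the branch for which the constant function $1$ has argument $0$. Let $\hat\Theta\in\mathbb R$ be the real-valued argument of $Z_\Omega=\int_X\frac{(\alpha+\sqrt{-1}\xi_0)^n}{n!}$, that is: $Z_\Omega\in\mathbb R_{>0}\,e^{\sqrt{-1}\hat\Theta}$, and the branch is the one given by the pointwise arguments, in the sense that $|\Theta_\alpha(\xi)-\hat\Theta|<\pi$ on $X$ for some $\xi\in\Omega$. (There is at most one such $\hat\Theta$.) Assume that $$\hat\Theta\in\Big((n-2)\frac{\pi}{2},\,n\frac{\pi}{2}\Big).$$ Call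 $\chi\in\Omega$ a *subsolution* of $\Theta_\alpha(\cdot)=\hat\Theta$ if for every $x\in X$, with $\mu=(\mu_1,\dots,\mu_n)$ the eigenvalues of $\alpha^{-1}\chi$ at $x$, the set $$\Big\{\mu'\in\Gamma:\ \sum_{i=1}^n\arctan\mu'_i=\hat\Theta,\ \ \mu'_i>\mu_i\ \text{for all } i\Big\}$$ is bounded in $\mathbb R^n$, where $\Gamma\subset\mathbb R^n$ is the cone through the origin over $\{y:\sum_i\arctan y_i\ge (n-2)\frac{\pi}{2}\}$. Then, for every $\chi\in\Omega$: 1. if $n$ is even, $\chi$ is a subsolution of $\Theta_\alpha(\cdot)=\hat\Theta$ if and only if on $X$ $$-(\sqrt{-1})^n\Big(\mathrm{Im}(\alpha+\sqrt{-1}\chi)^{n-1}+\cot(\hat\Theta)\,\mathrm{Re}(\alpha+\sqrt{-1}\chi)^{n-1}\Big)>0;$$ 2. if $n$ is odd, $\chi$ is a subsolution of $\Theta_\alpha(\cdot)=\hat\Theta$ if and only if on $X$ $$(\sqrt{-1})^{n-1}\Big(\tan(\hat\Theta)\,\mathrm{Im}(\alpha+\sqrt{-1}\chi)^{n-1}+\mathrm{Re}(\alpha+\sqrt{-1}\chi)^{n-1}\Big)>0.$$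 Here $>0$ means strict positivity in the sense of $(n-1,n-1)$-forms: the restriction of the form to every complex hyperplane of every tangent space is a positive volume form (for $n=1$, the function is positive). -/

import Mathlib

open scoped Manifold ContDiff

noncomputable section

namespace DHYM

/-! ### Multilinear algebra on `ℂⁿ`, regarded as a real vector space with complex structure `I • ·` -/

/-- The wedge product of complex-valued alternating forms, as the sum over shuffles
(so `(a ∧ b)(v, w) = a v * b w - a w * b v` for one-forms). -/
def wedge {n k l : ℕ} (a : (Fin n → ℂ) [⋀^Fin k]→ₗ[ℝ] ℂ) (b : (Fin n → ℂ) [⋀^Fin l]→ₗ[ℝ] ℂ) :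
    (Fin n → ℂ) [⋀^Fin (k + l)]→ₗ[ℝ] ℂ :=
  (LinearMap.mul' ℝ ℂ).compAlternatingMap ((a.domCoprod b).domDomCongr finSumFinEquiv)

/-- The `m`-th wedge power of a complex-valued two-form. -/
def wedgePow {n : ℕ} (a : (Fin n → ℂ) [⋀^Fin 2]→ₗ[ℝ] ℂ) :
    (m : ℕ) → (Fin n → ℂ) [⋀^Fin (2 * m)]→ₗ[ℝ] ℂ
  | 0 => AlternatingMap.constOfIsEmpty ℝ (Fin n → ℂ) (Fin 0) (1 : ℂ)
  | m + 1 => wedge (wedgePow a m) a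

/-- The real part of a complex-valued form (again viewed as complex-valued). -/
def reForm {n k : ℕ} (a : (Fin n → ℂ) [⋀^Fin k]→ₗ[ℝ] ℂ) : (Fin n → ℂ) [⋀^Fin k]→ₗ[ℝ] ℂ :=
  (Complex.ofRealCLM.toLinearMap ∘ₗ Complex.reLm).compAlternatingMap a

/-- The imaginary part of a complex-valued form (again viewed as complex-valued). -/
def imForm {n k : ℕ} (a : (Fin n → ℂ) [⋀^Fin k]→ₗ[ℝ] ℂ) : (Fin n → ℂ) [⋀^Fin k]→ₗ[ℝ] ℂ :=
  (Complex.ofRealCLM.toLinearMap ∘ₗ Complex.imLm).compAlternatingMap a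

/-- The complex-valued two-form `a + √-1 b` built from two real two-forms. -/
def addI {n : ℕ} (a b : (Fin n → ℂ) [⋀^Fin 2]→L[ℝ] ℝ) : (Fin n → ℂ) [⋀^Fin 2]→ₗ[ℝ] ℂ :=
  Complex.ofRealCLM.toLinearMap.compAlternatingMap a.toAlternatingMap +
    Complex.I • Complex.ofRealCLM.toLinearMap.compAlternatingMap b.toAlternatingMap

/-- The list `v₁, √-1 v₁, v₂, √-1 v₂, …`. -/
def complexFrame {n m : ℕ} (v : Fin m → Fin n → ℂ) : Fin (2 * m) → Fin n → ℂ := fun k =>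
  if (k : ℕ) % 2 = 0 then v ⟨k / 2, by omega⟩ else Complex.I • v ⟨k / 2, by omega⟩

/-- Strict positivity of an `(m, m)`-form: its restriction to every `m`-dimensional complex
subspace is a positive multiple of the canonical orientation of that subspace. For `m = n - 1`
this is the condition `a ∧ √-1 β ∧ β̄ > 0` for every non-zero `(1,0)`-covector `β`. -/
def IsStrictlyPositive {n m : ℕ} (a : (Fin n → ℂ) [⋀^Fin (2 * m)]→ₗ[ℝ] ℂ) : Prop :=
  ∀ v : Fin m → Fin n → ℂ, LinearIndependent ℂ v →
    0 < (a (complexFrame v)).re ∧ (a (complexFrame v)).im = 0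

/-- The Hermitian matrix `a_{j k̄}` of a real `(1,1)`-form `a = √-1 ∑ a_{j k̄} dz_j ∧ dz̄_k`. -/
def coeffMatrix {n : ℕ} (a : (Fin n → ℂ) [⋀^Fin 2]→L[ℝ] ℝ) : Matrix (Fin n) (Fin n) ℂ :=
  Matrix.of fun j k =>
    ((a ![Pi.single j 1, Complex.I • Pi.single k 1] : ℝ) -
      Complex.I * (a ![Pi.single j 1, Pi.single k 1] : ℝ)) / 2

/-- The endomorphism `Λ^i_j = a^{i k̄} b_{j k̄}` of a `(1,1)`-form `b` relative to a positive
`(1,1)`-form `a`, where `∑_k a^{i k̄} a_{j k̄} = δ_{ij}`. -/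
def relEndo {n : ℕ} (a b : (Fin n → ℂ) [⋀^Fin 2]→L[ℝ] ℝ) : Matrix (Fin n) (Fin n) ℂ :=
  ((coeffMatrix a).transpose)⁻¹ * (coeffMatrix b).transpose

/-- The eigenvalues, with multiplicity, of `b` relative to `a`. They are real numbers when `a` is
a positive `(1,1)`-form and `b` is a real `(1,1)`-form. -/
def relEigenvalues {n : ℕ} (a b : (Fin n → ℂ) [⋀^Fin 2]→L[ℝ] ℝ) : Multiset ℂ :=
  (relEndo a b).charpoly.roots

/-- The function `Θ(x₁, …, xₙ) = ∑ arctan xᵢ`. -/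
def arctanSum {n : ℕ} (x : Fin n → ℝ) : ℝ := ∑ i, Real.arctan (x i)

/-- The cone through the origin over `{x : Θ(x) ≥ (n - 2) π / 2}`. -/
def phaseCone (n : ℕ) : Set (Fin n → ℝ) :=
  {y | ∃ t : ℝ, 0 < t ∧ ∃ x : Fin n → ℝ,
    ((n : ℝ) - 2) * (Real.pi / 2) ≤ arctanSum x ∧ y = t • x}

/-! ### Forms on a complex manifold

The tangent space at `x` is identified with `ℂⁿ` through the preferred chart `chartAt _ x`, as for
Mathlib's `TangentSpace`. -/

section Manifold

variable {n : ℕ} {X : Type*} [TopologicalSpace X] [ChartedSpace (Fin n → ℂ) X]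

/-- For a chart `e` and a point `y` of its target, the differential of `e.symm` at `y`, as a map
from `ℂⁿ` to the tangent space at `e.symm y`. -/
def chartDeriv (e : OpenPartialHomeomorph X (Fin n → ℂ)) (y : Fin n → ℂ) :
    (Fin n → ℂ) →L[ℂ] (Fin n → ℂ) :=
  fderiv ℂ (fun z => chartAt (Fin n → ℂ) (e.symm y) (e.symm z)) y

/-- The expression of a field of real two-forms in the chart `e`. -/
def inChart (a : X → (Fin n → ℂ) [⋀^Fin 2]→L[ℝ] ℝ) (e : OpenPartialHomeomorph X (Fin n → ℂ))
    (y : Fin n → ℂ) : (Fin n → ℂ) [⋀^Fin 2]→L[ℝ] ℝ :=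
  (a (e.symm y)).compContinuousLinearMap ((chartDeriv e y).restrictScalars ℝ)

variable (n X) in
/-- A smooth real `(1,1)`-form on the complex manifold `X`. -/
structure OneOneForm where
  /-- the value of the form at a point -/
  val : X → (Fin n → ℂ) [⋀^Fin 2]→L[ℝ] ℝ
  /-- the form is of type `(1,1)`, i.e. invariant under the complex structure -/
  invariant : ∀ x v w, val x ![Complex.I • v, Complex.I • w] = val x ![v, w]
  /-- the form is smooth in every chart -/
  smooth : ∀ e ∈ atlas (Fin n → ℂ) X, ContDiffOn ℝ ∞ (inChart val e) e.target

/-- The form is `d`-closed. -/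
def OneOneForm.IsClosed (a : OneOneForm n X) : Prop :=
  ∀ e ∈ atlas (Fin n → ℂ) X, ∀ y ∈ e.target, extDeriv (inChart a.val e) y = 0

/-- A Kähler form: a closed, positive `(1,1)`-form. -/
def OneOneForm.IsKahler (a : OneOneForm n X) : Prop :=
  a.IsClosed ∧ ∀ x v, v ≠ 0 → 0 < a.val x ![v, Complex.I • v]

/-- `(√-1 ∂∂̄ u)(v, w)` at the point `x`. In terms of the real second derivative in a holomorphic
chart it is `(D²u(√-1 v, w) - D²u(v, √-1 w)) / 2`, i.e. `d dᶜ u / 2` with `dᶜ u = - du ∘ √-1`. -/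
def ddbar (u : X → ℝ) (x : X) (v w : Fin n → ℂ) : ℝ :=
  let f : (Fin n → ℂ) → ℝ := fun y => u ((chartAt (Fin n → ℂ) x).symm y)
  let p : Fin n → ℂ := chartAt (Fin n → ℂ) x x
  (fderiv ℝ (fderiv ℝ f) p (Complex.I • v) w - fderiv ℝ (fderiv ℝ f) p v (Complex.I • w)) / 2

/-- The cohomology class of `a` in `H^{1,1}(X, ℝ)`: all forms `a + √-1 ∂∂̄ u`, with `u` a smooth
real function. -/
def OneOneForm.cohomologyClass (a : OneOneForm n X) : Set (OneOneForm n X) :=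
  {b | ∃ u : X → ℝ, ContMDiff 𝓘(ℝ, Fin n → ℂ) 𝓘(ℝ, ℝ) ∞ u ∧
    ∀ x v w, b.val x ![v, w] = a.val x ![v, w] + ddbar u x v w}

/-- The Lagrangian phase `Θ_α(b) = ∑ arctan λᵢ` at `x`, with `λᵢ` the eigenvalues of `b` relative
to `α`. It is the argument of `(α + √-1 b)ⁿ / αⁿ` on the branch for which the constant function
`1` has argument zero. -/
def phase (α b : OneOneForm n X) (x : X) : ℝ :=
  ((relEigenvalues (α.val x) (b.val x)).map fun z => Real.arctan z.re).sum

/-- `χ` is a `𝒞`-subsolution of `Θ_α(·) = h`: at each point `x`, with `μ` the `n`-tuple of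
eigenvalues of `χ` relative to `α`, the set
`{μ' ∈ Γ : ∑ arctan μ'ᵢ = h x, μ' - μ ∈ Γₙ}` is bounded, `Γₙ` being the positive orthant. -/
def IsSubsolution (α : OneOneForm n X) (h : X → ℝ) (χ : OneOneForm n X) : Prop :=
  ∀ x, ∃ μ : Fin n → ℝ,
    relEigenvalues (α.val x) (χ.val x) = Finset.univ.val.map (fun i => (μ i : ℂ)) ∧
    Bornology.IsBounded
      {μ' : Fin n → ℝ | μ' ∈ phaseCone n ∧ arctanSum μ' = h x ∧ ∀ i, 0 < (μ' - μ) i}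

/-! ### Integration of top-degree forms -/

/-- The density, in the chart `e`, of a field of `2n`-forms with respect to
`dx₁ dy₁ ⋯ dxₙ dyₙ`. -/
def topDensity (a : X → (Fin n → ℂ) [⋀^Fin (2 * n)]→ₗ[ℝ] ℂ)
    (e : OpenPartialHomeomorph X (Fin n → ℂ)) (y : Fin n → ℂ) : ℂ :=
  a (e.symm y) (complexFrame fun j : Fin n => chartDeriv e y (Pi.single j 1))

variable (n X) in
/-- A partition of unity subordinate to the preferred charts. -/
def chartPartition [T2Space X] [CompactSpace X] : PartitionOfUnity X X Set.univ :=
  Classical.choose (PartitionOfUnity.exists_isSubordinate isClosed_univ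
    (fun x : X => (chartAt (Fin n → ℂ) x).source) (fun x => (chartAt (Fin n → ℂ) x).open_source)
    (fun x _ => Set.mem_iUnion.2 ⟨x, mem_chart_source (Fin n → ℂ) x⟩))

/-- The integral `∫_X a` of a `2n`-form over the compact complex manifold `X` with its canonical
orientation. -/
def integral [T2Space X] [CompactSpace X] (a : X → (Fin n → ℂ) [⋀^Fin (2 * n)]→ₗ[ℝ] ℂ) : ℂ :=
  ∑ᶠ x : X, ∫ y in (chartAt (Fin n → ℂ) x).target,
    (chartPartition n X x ((chartAt (Fin n → ℂ) x).symm y) : ℂ) *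
      topDensity a (chartAt (Fin n → ℂ) x) y

/-- The number `Z = ∫_X (α + √-1 b)ⁿ / n!`, which depends only on the classes of `α` and `b`. -/
def centralCharge [T2Space X] [CompactSpace X] (α b : OneOneForm n X) : ℂ :=
  integral (fun x => wedgePow (addI (α.val x) (b.val x)) n) / (n.factorial : ℂ)

/-- `θ` is the real-valued argument of the number `Z` of the class `Ω` of `b`: `Z` is a positive
multiple of `exp (√-1 θ)`, and the branch is the one given by the phase functions `Θ_α(ξ)`,
`ξ ∈ Ω`, i.e. by the pointwise argument of `(α + √-1 ξ)ⁿ / αⁿ` normalised so that the function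
`1` has argument zero: for some `ξ ∈ Ω` the phase stays within `π` of `θ`. There is at most one
such `θ`. -/
def IsLiftedArg [T2Space X] [CompactSpace X] (α b : OneOneForm n X) (θ : ℝ) : Prop :=
  (∃ r : ℝ, 0 < r ∧ centralCharge α b = r * Complex.exp (θ * Complex.I)) ∧
    ∃ ξ ∈ b.cohomologyClass, ∀ x, |phase α ξ x - θ| < Real.pi

end Manifold

end DHYM

end

noncomputable section

namespace DHYM

open Matrix ComplexConjugate ComplexOrder

/-! Write `S i` for the sum of all `arctan μ j` with `j ≠ i`. Two pointwise facts about `S` carry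
the proof. First, the set in the definition of a subsolution is bounded exactly when `θ - π/2 < S i`
for every `i` (`isBounded_phase_iff`): the remaining coordinate can escape to infinity, its phase
tending to `π/2`, precisely when the others leave room for it. Second, both displayed forms are
positive multiples of `Re (exp (-√-1 θ) (α + √-1 χ)ⁿ⁻¹)`. In coordinates diagonalizing `α` and `χ`,
a Cauchy–Binet expansion evaluates this form on a hyperplane as a combination of the numbers `cos (S
i - θ)` with nonnegative weights, not all zero. Positivity therefore means `0 < cos (S i - θ)` for
all `i` (`Diagonalizes.isStrictlyPositive_iff`).

The first condition implies the second because `S i ≤ (n - 1) π/2 < θ + π/2`. Conversely the cosine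
sees `S i - θ` only modulo `2π`, and the branch has to be recovered globally. If `ξ` is the
representative with phase within `π` of `θ`, then where the difference of the potentials of `ξ` and
`χ` is maximal, `ξ ≤ χ` as forms, so the phase of `χ` exceeds `θ - π` there (`exists_phase_le`). At
that point every `S i - θ` exceeds `-3π/2`, and positivity of the cosine improves this to `-π/2`.
The ordered eigenvalues are continuous by the min-max principle (`continuous_eigenvalue`) and `X` is
connected, so the inequality persists everywhere (`lt_of_cos_pos`). -/

/-! ### Subsolutions and partial sums of phases -/

theorem mem_phaseCone_of_le {n : ℕ} {y : Fin n → ℝ}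
    (h : ((n : ℝ) - 2) * (Real.pi / 2) ≤ arctanSum y) : y ∈ phaseCone n :=
  ⟨1, one_pos, y, h, (one_smul ℝ y).symm⟩

theorem arctanSum_sub_arctan_le {n : ℕ} (x : Fin n → ℝ) (i : Fin n) :
    arctanSum x - Real.arctan (x i) ≤ ((n : ℝ) - 1) * (Real.pi / 2) := by
  have h : arctanSum x - Real.arctan (x i) = ∑ j ∈ Finset.univ.erase i, Real.arctan (x j) := by
    rw [arctanSum, ← Finset.add_sum_erase _ _ (Finset.mem_univ i)]; ring
  rw [h]
  refine (Finset.sum_le_card_nsmul _ _ (Real.pi / 2) fun j _ => (Real.arctan_lt_pi_div_two _).le).trans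
    (le_of_eq ?_)
  have hn : 1 ≤ n := i.pos
  rw [Finset.card_erase_of_mem (Finset.mem_univ i), Finset.card_univ, Fintype.card_fin, nsmul_eq_mul,
    Nat.cast_sub hn, Nat.cast_one]

/-- If the sum of the phases of `μ` other than the `i`-th is at most `θ - π / 2`, then the tuples of
phase `θ` above `μ` reach arbitrarily far in the `i`-th direction. -/
theorem exists_arctanSum_eq_gt {n : ℕ} {θ : ℝ} (hθ : θ < (n : ℝ) * (Real.pi / 2))
    (μ : Fin n → ℝ) (i : Fin n) (hi : arctanSum μ - Real.arctan (μ i) ≤ θ - Real.pi / 2) (R : ℝ) :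
    ∃ y : Fin n → ℝ, arctanSum y = θ ∧ (∀ j, μ j < y j) ∧ R < y i := by
  set L := arctanSum μ - Real.arctan (μ i) with hL
  have hRμ : Real.arctan (max R (μ i)) < Real.pi / 2 := Real.arctan_lt_pi_div_two _
  have hRμ' : -(Real.pi / 2) < Real.arctan (max R (μ i)) := Real.neg_pi_div_two_lt_arctan _
  -- `η` will be the gap between `π/2` and the phase of `y i`: small enough that `y i` exceeds `R`
  -- and `μ i`, and below `n π/2 - θ` so that the other phases can stay below `π/2`.
  obtain ⟨η, hη0, hη⟩ := exists_between
    (lt_min (sub_pos.2 hθ) (sub_pos.2 hRμ))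
  obtain ⟨hη1, hη2⟩ := lt_min_iff.1 hη
  set D := ((n : ℝ) - 1) * (Real.pi / 2) - L with hD
  set s := (θ - Real.pi / 2 + η - L) / D with hs
  have hnum : 0 < θ - Real.pi / 2 + η - L := by linarith
  have hlt : θ - Real.pi / 2 + η - L < D := by rw [hD]; nlinarith
  have hDpos : 0 < D := hnum.trans hlt
  have hs0 : 0 < s := div_pos hnum hDpos
  have hs1 : s < 1 := (div_lt_one hDpos).2 hlt
  have hsD : s * D = θ - Real.pi / 2 + η - L := div_mul_cancel₀ _ hDpos.ne'
  -- All other phases move by the same fraction `s` of their distance to `π/2`; `s` is the fraction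
  -- that makes the total equal to `θ`.
  set φ : Fin n → ℝ := fun j => Real.arctan (μ j) + s * (Real.pi / 2 - Real.arctan (μ j)) with hφ
  have hφ1 : ∀ j, Real.arctan (μ j) < φ j := fun j => by
    have := Real.arctan_lt_pi_div_two (μ j)
    simp only [hφ]; nlinarith
  have hφ2 : ∀ j, φ j < Real.pi / 2 := fun j => by
    have := Real.arctan_lt_pi_div_two (μ j)
    simp only [hφ]; nlinarith
  set ψ : Fin n → ℝ := Function.update φ i (Real.pi / 2 - η) with hψ
  have hψi : ψ i = Real.pi / 2 - η := by simp [hψ]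
  have hψj : ∀ j, j ≠ i → ψ j = φ j := fun j hj => by simp [hψ, hj]
  have hψ2 : ∀ j, ψ j < Real.pi / 2 := fun j => by
    rcases eq_or_ne j i with rfl | hj
    · rw [hψi]; linarith
    · rw [hψj j hj]; exact hφ2 j
  have hψ1 : ∀ j, Real.arctan (μ j) < ψ j := fun j => by
    rcases eq_or_ne j i with rfl | hj
    · rw [hψi]
      have : Real.arctan (μ j) ≤ Real.arctan (max R (μ j)) := Real.arctan_mono (le_max_right _ _)
      linarith
    · rw [hψj j hj]; exact hφ1 j
  have harc : ∀ j, Real.arctan (Real.tan (ψ j)) = ψ j := fun j =>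
    Real.arctan_tan ((Real.neg_pi_div_two_lt_arctan _).trans (hψ1 j)) (hψ2 j)
  refine ⟨fun j => Real.tan (ψ j), ?_, fun j => ?_, ?_⟩
  · have hcard : (((Finset.univ.erase i).card : ℕ) : ℝ) = (n : ℝ) - 1 := by
      have hn : 1 ≤ n := i.pos
      rw [Finset.card_erase_of_mem (Finset.mem_univ i), Finset.card_univ, Fintype.card_fin,
        Nat.cast_sub hn, Nat.cast_one]
    have hLs : L = ∑ j ∈ Finset.univ.erase i, Real.arctan (μ j) := by
      rw [hL, arctanSum, ← Finset.add_sum_erase _ _ (Finset.mem_univ i)]; ring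
    have hsum : ∑ j ∈ Finset.univ.erase i, ψ j = L + s * D := by
      rw [Finset.sum_congr rfl fun j hj => hψj j (Finset.ne_of_mem_erase hj)]
      simp only [hφ]
      rw [Finset.sum_add_distrib, ← Finset.mul_sum, Finset.sum_sub_distrib, Finset.sum_const,
        nsmul_eq_mul, hcard, ← hLs]
    simp only [arctanSum, harc]
    rw [← Finset.add_sum_erase _ _ (Finset.mem_univ i), hsum, hψi, hsD]
    ring
  · rw [← Real.arctan_lt_arctan_iff, harc]; exact hψ1 j
  · rw [← Real.arctan_lt_arctan_iff, harc, hψi]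
    have : Real.arctan R ≤ Real.arctan (max R (μ i)) := Real.arctan_mono (le_max_left _ _)
    linarith

/-- The boundedness condition defining a subsolution, in terms of partial sums of phases. -/
theorem isBounded_phase_iff {n : ℕ} {θ : ℝ} (hθ₁ : ((n : ℝ) - 2) * (Real.pi / 2) < θ)
    (hθ₂ : θ < (n : ℝ) * (Real.pi / 2)) (μ : Fin n → ℝ) :
    Bornology.IsBounded
      {y : Fin n → ℝ | y ∈ phaseCone n ∧ arctanSum y = θ ∧ ∀ i, 0 < (y - μ) i} ↔
    ∀ i, θ - Real.pi / 2 < arctanSum μ - Real.arctan (μ i) := by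
  constructor
  · intro hb i
    by_contra! hi
    obtain ⟨C, hC⟩ := hb.exists_norm_le
    obtain ⟨y, hy, hμ, hyi⟩ := exists_arctanSum_eq_gt hθ₂ μ i hi C
    have h1 := hC y ⟨mem_phaseCone_of_le (by rw [hy]; exact hθ₁.le), hy, fun j => by
      simpa using hμ j⟩
    have h2 := (norm_le_pi_norm y i).trans h1
    exact absurd ((le_abs_self _).trans h2) (not_le.2 hyi)
  · intro h
    -- The set lies in a box: raising the other coordinates only lowers the phase left for `y i`,
    -- which is thus at most `θ - S i < π/2`.
    refine (isCompact_Icc (a := μ)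
      (b := fun i => Real.tan (θ - (arctanSum μ - Real.arctan (μ i))))).isBounded.subset ?_
    rintro y ⟨-, hy, hμ⟩
    have hμ' : ∀ i, μ i < y i := fun i => by simpa using hμ i
    refine ⟨fun i => (hμ' i).le, fun i => ?_⟩
    have hle : arctanSum μ - Real.arctan (μ i) ≤ arctanSum y - Real.arctan (y i) := by
      simp only [arctanSum]
      rw [← Finset.add_sum_erase _ _ (Finset.mem_univ i),
        ← Finset.add_sum_erase (a := i) _ (fun j => Real.arctan (y j)) (Finset.mem_univ i),
        add_sub_cancel_left, add_sub_cancel_left]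
      exact Finset.sum_le_sum fun j _ => Real.arctan_mono (hμ' j).le
    have hup : Real.arctan (y i) ≤ θ - (arctanSum μ - Real.arctan (μ i)) := by
      rw [hy] at hle; linarith
    have h1 := h i
    have h2 := Real.neg_pi_div_two_lt_arctan (y i)
    rw [← Real.arctan_le_arctan_iff, Real.arctan_tan (by linarith) (by linarith)]
    exact hup

/-! ### Invariant two-forms as Hermitian forms, and simultaneous diagonalization -/

section Pencil

variable {n : ℕ}

/-- A real two-form invariant under the complex structure. -/
def IsInvariant (a : (Fin n → ℂ) [⋀^Fin 2]→L[ℝ] ℝ) : Prop :=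
  ∀ v w, a ![Complex.I • v, Complex.I • w] = a ![v, w]

theorem update_pair_zero (u v w : Fin n → ℂ) : Function.update ![v, w] 0 u = ![u, w] := by
  ext i
  fin_cases i <;> simp

theorem twoForm_add_left (a : (Fin n → ℂ) [⋀^Fin 2]→L[ℝ] ℝ) (v v' w : Fin n → ℂ) :
    a ![v + v', w] = a ![v, w] + a ![v', w] := by
  have h := a.toAlternatingMap.map_update_add ![v, w] 0 v v'
  rw [update_pair_zero, update_pair_zero, update_pair_zero] at h
  exact h

theorem twoForm_smul_left (a : (Fin n → ℂ) [⋀^Fin 2]→L[ℝ] ℝ) (r : ℝ) (v w : Fin n → ℂ) :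
    a ![r • v, w] = r * a ![v, w] := by
  have h := a.toAlternatingMap.map_update_smul ![v, w] 0 r v
  rw [update_pair_zero, update_pair_zero] at h
  exact h

theorem twoForm_swap (a : (Fin n → ℂ) [⋀^Fin 2]→L[ℝ] ℝ) (v w : Fin n → ℂ) :
    a ![w, v] = -a ![v, w] := by
  have h := a.toAlternatingMap.map_swap ![v, w] (i := 0) (j := 1) (by decide)
  have h2 : (![v, w] ∘ Equiv.swap (0 : Fin 2) 1) = ![w, v] := by
    ext i; fin_cases i <;> simp
  rw [h2] at h
  simpa using h

theorem twoForm_self (a : (Fin n → ℂ) [⋀^Fin 2]→L[ℝ] ℝ) (v : Fin n → ℂ) : a ![v, v] = 0 := by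
  have := twoForm_swap a v v
  linarith

theorem twoForm_add_right (a : (Fin n → ℂ) [⋀^Fin 2]→L[ℝ] ℝ) (v w w' : Fin n → ℂ) :
    a ![v, w + w'] = a ![v, w] + a ![v, w'] := by
  rw [twoForm_swap, twoForm_add_left, twoForm_swap a v w, twoForm_swap a v w']; ring

theorem twoForm_smul_right (a : (Fin n → ℂ) [⋀^Fin 2]→L[ℝ] ℝ) (r : ℝ) (v w : Fin n → ℂ) :
    a ![v, r • w] = r * a ![v, w] := by
  rw [twoForm_swap, twoForm_smul_left, twoForm_swap a v w]; ring

theorem I_smul_I_smul (v : Fin n → ℂ) : Complex.I • Complex.I • v = (-1 : ℝ) • v := by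
  rw [smul_smul, Complex.I_mul_I]; ext; simp

theorem IsInvariant.I_left {a : (Fin n → ℂ) [⋀^Fin 2]→L[ℝ] ℝ} (ha : IsInvariant a)
    (v w : Fin n → ℂ) : a ![Complex.I • v, w] = -a ![v, Complex.I • w] := by
  rw [← ha (Complex.I • v) w, I_smul_I_smul, twoForm_smul_left]; ring

theorem complex_smul_eq (c : ℂ) (v : Fin n → ℂ) :
    c • v = c.re • v + c.im • (Complex.I • v) := by
  ext i
  simp only [Pi.smul_apply, Pi.add_apply, Complex.real_smul, smul_eq_mul]
  conv_lhs => rw [← Complex.re_add_im c]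
  ring

/-- The Hermitian form whose imaginary part is the invariant two-form `a`. -/
def hermForm (a : (Fin n → ℂ) [⋀^Fin 2]→L[ℝ] ℝ) (v w : Fin n → ℂ) : ℂ :=
  a ![v, Complex.I • w] + Complex.I * a ![v, w]

theorem hermForm_add_left (a : (Fin n → ℂ) [⋀^Fin 2]→L[ℝ] ℝ) (v v' w : Fin n → ℂ) :
    hermForm a (v + v') w = hermForm a v w + hermForm a v' w := by
  simp only [hermForm, twoForm_add_left]; push_cast; ring

theorem hermForm_add_right (a : (Fin n → ℂ) [⋀^Fin 2]→L[ℝ] ℝ) (v w w' : Fin n → ℂ) :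
    hermForm a v (w + w') = hermForm a v w + hermForm a v w' := by
  simp only [hermForm, twoForm_add_right, smul_add]; push_cast; ring

theorem hermForm_smul_right (a : (Fin n → ℂ) [⋀^Fin 2]→L[ℝ] ℝ) (c : ℂ) (v w : Fin n → ℂ) :
    hermForm a v (c • w) = c * hermForm a v w := by
  have h : Complex.I • c • w = c.re • (Complex.I • w) + (-c.im) • w := by
    rw [smul_comm, complex_smul_eq c (Complex.I • w), I_smul_I_smul, smul_smul, mul_neg_one]
  simp only [hermForm]
  rw [h, complex_smul_eq c w]
  simp only [twoForm_add_right, twoForm_smul_right]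
  conv_rhs => rw [← Complex.re_add_im c]
  push_cast
  linear_combination -(c.im * (a ![v, w] : ℂ)) * Complex.I_mul_I

theorem IsInvariant.hermForm_conj {a : (Fin n → ℂ) [⋀^Fin 2]→L[ℝ] ℝ} (ha : IsInvariant a)
    (v w : Fin n → ℂ) : hermForm a w v = conj (hermForm a v w) := by
  simp only [hermForm, map_add, map_mul, Complex.conj_ofReal, Complex.conj_I]
  rw [twoForm_swap a v w, twoForm_swap a (Complex.I • v) w, ha.I_left]
  push_cast; ring

theorem IsInvariant.hermForm_smul_left {a : (Fin n → ℂ) [⋀^Fin 2]→L[ℝ] ℝ} (ha : IsInvariant a)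
    (c : ℂ) (v w : Fin n → ℂ) : hermForm a (c • v) w = conj c * hermForm a v w := by
  rw [ha.hermForm_conj, hermForm_smul_right, map_mul, ← ha.hermForm_conj]

/-- The Hermitian form as a sesquilinear map. -/
def IsInvariant.sesq {a : (Fin n → ℂ) [⋀^Fin 2]→L[ℝ] ℝ} (ha : IsInvariant a) :
    (Fin n → ℂ) →ₗ⋆[ℂ] (Fin n → ℂ) →ₗ[ℂ] ℂ :=
  LinearMap.mk₂'ₛₗ _ _ (hermForm a) (hermForm_add_left a)
    (fun c v w => ha.hermForm_smul_left c v w) (hermForm_add_right a)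
    (fun c v w => hermForm_smul_right a c v w)

/-- Explains the transposes in `relEndo`: with the form conjugate-linear in its first slot, it is
the transposed coefficient matrix that is half the Gram matrix. -/
theorem coeffMatrix_transpose_apply {a : (Fin n → ℂ) [⋀^Fin 2]→L[ℝ] ℝ} (ha : IsInvariant a)
    (j k : Fin n) :
    (coeffMatrix a)ᵀ j k = hermForm a (Pi.single j 1) (Pi.single k 1) / 2 := by
  rw [ha.hermForm_conj (Pi.single k 1)]
  simp [coeffMatrix, hermForm, Matrix.transpose_apply, sub_eq_add_neg]

theorem IsInvariant.hermForm_eq {a : (Fin n → ℂ) [⋀^Fin 2]→L[ℝ] ℝ} (ha : IsInvariant a)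
    (v w : Fin n → ℂ) : hermForm a v w = 2 * (star v ⬝ᵥ ((coeffMatrix a)ᵀ *ᵥ w)) := by
  have h1 : hermForm a v w = ha.sesq v w := rfl
  have h2 : ∀ j k, ha.sesq (Pi.single j 1) (Pi.single k 1) =
      hermForm a (Pi.single j 1) (Pi.single k 1) := fun _ _ => rfl
  rw [h1]
  conv_lhs => rw [pi_eq_sum_univ' v, pi_eq_sum_univ' w]
  simp only [map_sum, map_smulₛₗ, LinearMap.sum_apply, LinearMap.smul_apply, smul_eq_mul,
    RingHom.id_apply, dotProduct, mulVec, coeffMatrix_transpose_apply ha, Finset.mul_sum]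
  rw [Finset.sum_comm]
  refine Finset.sum_congr rfl fun j _ => Finset.sum_congr rfl fun k _ => ?_
  have e1 : (fun i => if j = i then (1 : ℂ) else 0) = Pi.single j 1 := by
    ext i; simp [Pi.single_apply, eq_comm]
  have e2 : (fun i => if k = i then (1 : ℂ) else 0) = Pi.single k 1 := by
    ext i; simp [Pi.single_apply, eq_comm]
  first
    | rw [e1, e2, h2]
    | rw [h2]
  simp only [Pi.star_apply, starRingEnd_apply]
  ring

theorem hermForm_im (a : (Fin n → ℂ) [⋀^Fin 2]→L[ℝ] ℝ) (v w : Fin n → ℂ) :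
    (hermForm a v w).im = a ![v, w] := by
  simp [hermForm]

theorem IsInvariant.isHermitian {a : (Fin n → ℂ) [⋀^Fin 2]→L[ℝ] ℝ} (ha : IsInvariant a) :
    ((coeffMatrix a)ᵀ).IsHermitian := by
  ext j k
  rw [conjTranspose_apply, coeffMatrix_transpose_apply ha, coeffMatrix_transpose_apply ha,
    ha.hermForm_conj (Pi.single j 1), star_div₀, starRingEnd_apply, star_star, star_ofNat]

theorem IsInvariant.posDef {a : (Fin n → ℂ) [⋀^Fin 2]→L[ℝ] ℝ} (ha : IsInvariant a)
    (hpos : ∀ v, v ≠ 0 → 0 < a ![v, Complex.I • v]) : ((coeffMatrix a)ᵀ).PosDef := by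
  refine .of_dotProduct_mulVec_pos ha.isHermitian fun v hv => ?_
  have h := ha.hermForm_eq v v
  rw [hermForm, twoForm_self, Complex.ofReal_zero, mul_zero, add_zero] at h
  have h' : star v ⬝ᵥ ((coeffMatrix a)ᵀ *ᵥ v) = ((a ![v, Complex.I • v] / 2 : ℝ) : ℂ) := by
    push_cast
    linear_combination (-1 / 2 : ℂ) * h
  rw [h']
  exact_mod_cast half_pos (hpos v hv)

open scoped MatrixOrder Matrix.Norms.L2Operator in
theorem exists_eq_conjTranspose_mul_self {A : Matrix (Fin n) (Fin n) ℂ} (hA : A.PosDef) :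
    ∃ S : Matrix (Fin n) (Fin n) ℂ, IsUnit S ∧ A = Sᴴ * S := by
  obtain ⟨S, hS, h⟩ := CStarAlgebra.isStrictlyPositive_iff_eq_star_mul_self.mp
    hA.isStrictlyPositive
  exact ⟨S, hS, h⟩

/-- Simultaneous diagonalization of a positive definite and a Hermitian matrix. -/
theorem exists_simultaneous_diagonalization {A B : Matrix (Fin n) (Fin n) ℂ} (hA : A.PosDef)
    (hB : B.IsHermitian) :
    ∃ (Q : Matrix (Fin n) (Fin n) ℂ) (μ : Fin n → ℝ), IsUnit Q.det ∧ A = Qᴴ * Q ∧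
      B = Qᴴ * diagonal (fun i => (μ i : ℂ)) * Q := by
  obtain ⟨S, hS, hAS⟩ := exists_eq_conjTranspose_mul_self hA
  have hSd : IsUnit S.det := (Matrix.isUnit_iff_isUnit_det S).1 hS
  have hC : (S⁻¹ᴴ * B * S⁻¹).IsHermitian := by
    simpa using isHermitian_conjTranspose_mul_mul (S⁻¹) hB
  set U : Matrix (Fin n) (Fin n) ℂ := (hC.eigenvectorUnitary : Matrix (Fin n) (Fin n) ℂ) with hU
  have hUU : U * star U = 1 := Unitary.coe_mul_star_self hC.eigenvectorUnitary
  have hspec : S⁻¹ᴴ * B * S⁻¹ = U * diagonal (fun i => (hC.eigenvalues i : ℂ)) * star U := by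
    have := hC.spectral_theorem
    rw [Unitary.conjStarAlgAut_apply] at this
    exact this
  have h1 : S⁻¹ * S = 1 := nonsing_inv_mul S hSd
  have h1' : Sᴴ * S⁻¹ᴴ = 1 := by rw [← conjTranspose_mul, h1, conjTranspose_one]
  -- With `A = Sᴴ S`, the unitary `U` diagonalizes `B` transported by `S⁻¹` and leaves the identity,
  -- the transported `A`, unchanged.
  refine ⟨star U * S, hC.eigenvalues, ?_, ?_, ?_⟩
  · rw [det_mul]
    refine IsUnit.mul ?_ hSd
    have := congrArg det hUU
    rw [det_mul, det_one] at this
    exact IsUnit.of_mul_eq_one _ ((mul_comm _ _).trans this)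
  · rw [hAS, conjTranspose_mul, star_eq_conjTranspose, conjTranspose_conjTranspose]
    rw [star_eq_conjTranspose] at hUU
    calc Sᴴ * S = Sᴴ * (U * Uᴴ) * S := by rw [hUU, mul_one]
      _ = _ := by simp only [Matrix.mul_assoc]
  · calc B = (Sᴴ * S⁻¹ᴴ) * B * (S⁻¹ * S) := by rw [h1, h1', one_mul, mul_one]
      _ = Sᴴ * (S⁻¹ᴴ * B * S⁻¹) * S := by simp only [Matrix.mul_assoc]
      _ = Sᴴ * (U * diagonal (fun i => (hC.eigenvalues i : ℂ)) * star U) * S := by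
        exact congrArg (fun M => Sᴴ * M * S) hspec
      _ = _ := by
        rw [conjTranspose_mul, star_eq_conjTranspose, conjTranspose_conjTranspose]
        simp only [Matrix.mul_assoc]

/-- The product collapses to `Q⁻¹ * diagonal d * Q`, a conjugate of the diagonal matrix. -/
theorem roots_charpoly_inv_mul {Q : Matrix (Fin n) (Fin n) ℂ} (hQ : IsUnit Q.det)
    (d : Fin n → ℂ) :
    ((Qᴴ * Q)⁻¹ * (Qᴴ * diagonal d * Q)).charpoly.roots = Finset.univ.val.map d := by
  have hQ' : IsUnit (Qᴴ).det := by rw [det_conjTranspose]; exact hQ.star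
  have h : (Qᴴ * Q)⁻¹ * (Qᴴ * diagonal d * Q) = Q⁻¹ * (diagonal d * Q) := by
    rw [Matrix.mul_inv_rev]
    calc Q⁻¹ * Qᴴ⁻¹ * (Qᴴ * diagonal d * Q) = Q⁻¹ * (Qᴴ⁻¹ * Qᴴ) * (diagonal d * Q) := by
          simp only [Matrix.mul_assoc]
      _ = _ := by rw [nonsing_inv_mul _ hQ', Matrix.mul_one]
  rw [h, charpoly_mul_comm, Matrix.mul_assoc, mul_nonsing_inv _ hQ, Matrix.mul_one,
    charpoly_diagonal, Polynomial.roots_prod]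
  · simp
  · simp [Finset.prod_ne_zero_iff, Polynomial.X_sub_C_ne_zero]

/-- The data of a simultaneous diagonalization of `a` and `b`: complex linear coordinates in which
`a` is the standard form and `b` is diagonal, with antitone entries `μ`. -/
structure Diagonalizes (a b : (Fin n → ℂ) [⋀^Fin 2]→L[ℝ] ℝ) (μ : Fin n → ℝ)
    (L : (Fin n → ℂ) ≃ₗ[ℂ] (Fin n → ℂ)) : Prop where
  antitone : Antitone μ
  left : ∀ v w, a ![v, w] = ∑ j, (conj (L v j) * L w j).im
  right : ∀ v w, b ![v, w] = ∑ j, μ j * (conj (L v j) * L w j).im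
  roots : relEigenvalues a b = Finset.univ.val.map (fun i => (μ i : ℂ))

theorem exists_diagonalizes {a b : (Fin n → ℂ) [⋀^Fin 2]→L[ℝ] ℝ} (ha : IsInvariant a)
    (hpos : ∀ v, v ≠ 0 → 0 < a ![v, Complex.I • v]) (hb : IsInvariant b) :
    ∃ μ L, Diagonalizes a b μ L := by
  obtain ⟨Q, μ, hQ, hA, hB⟩ := exists_simultaneous_diagonalization (ha.posDef hpos) hb.isHermitian
  -- Sorting `-μ` increasingly lists the eigenvalues in decreasing order, which both min-max and the
  -- branch argument rely on.
  set σ : Equiv.Perm (Fin n) := Tuple.sort (fun i => -μ i) with hσ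
  have hs2 : IsUnit ((Real.sqrt 2 : ℝ) : ℂ) := by
    rw [isUnit_iff_ne_zero]; exact_mod_cast (Real.sqrt_pos.2 two_pos).ne'
  have hs : ((Real.sqrt 2 : ℝ) : ℂ) * ((Real.sqrt 2 : ℝ) : ℂ) = 2 := by
    rw [← Complex.ofReal_mul, Real.mul_self_sqrt zero_le_two]; norm_num
  -- The factor `√2` absorbs the `1/2` in `coeffMatrix`.
  have hM : IsUnit ((Real.sqrt 2 : ℂ) • Q) := by
    rw [Matrix.isUnit_iff_isUnit_det, det_smul]
    exact (hs2.pow _).mul hQ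
  set L : (Fin n → ℂ) ≃ₗ[ℂ] (Fin n → ℂ) :=
    (Matrix.toLinearEquiv' _ hM.invertible).trans (LinearEquiv.funCongrLeft ℂ ℂ σ) with hL
  have hLv : ∀ v j, L v j = (Real.sqrt 2 : ℂ) * (Q *ᵥ v) (σ j) := fun v j => by
    simp [hL, LinearEquiv.funCongrLeft_apply, LinearMap.funLeft_apply, Matrix.toLinearEquiv']
  have hprod : ∀ v w j, conj (L v j) * L w j = 2 * (conj ((Q *ᵥ v) (σ j)) * (Q *ᵥ w) (σ j)) := by
    intro v w j
    rw [hLv, hLv, map_mul, Complex.conj_ofReal]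
    linear_combination (conj ((Q *ᵥ v) (σ j)) * (Q *ᵥ w) (σ j)) * hs
  have hherm : ∀ (d : Fin n → ℂ) v w, star v ⬝ᵥ ((Qᴴ * diagonal d * Q) *ᵥ w) =
      ∑ j, d j * (conj ((Q *ᵥ v) j) * (Q *ᵥ w) j) := fun d v w => by
    rw [← Matrix.mulVec_mulVec, ← Matrix.mulVec_mulVec, dotProduct_mulVec, ← star_mulVec,
      dotProduct]
    refine Finset.sum_congr rfl fun j _ => ?_
    rw [mulVec_diagonal, Pi.star_apply, starRingEnd_apply]
    ring
  refine ⟨μ ∘ σ, L, ?_, ?_, ?_, ?_⟩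
  · intro i j hij
    have := Tuple.monotone_sort (fun i => -μ i) hij
    simpa using this
  · intro v w
    have hA' : (coeffMatrix a)ᵀ = Qᴴ * diagonal (fun _ => (1 : ℂ)) * Q := by
      rw [hA, diagonal_one, Matrix.mul_one]
    rw [← hermForm_im, ha.hermForm_eq, hA', hherm, Finset.mul_sum, Complex.im_sum]
    simp only [hprod, one_mul]
    exact (Equiv.sum_comp σ fun j => (2 * (conj ((Q *ᵥ v) j) * (Q *ᵥ w) j)).im).symm
  · intro v w
    rw [← hermForm_im, hb.hermForm_eq, hB, hherm, Finset.mul_sum, Complex.im_sum]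
    simp only [hprod, Function.comp]
    rw [← Equiv.sum_comp σ]
    refine Finset.sum_congr rfl fun j _ => ?_
    rw [← Complex.im_ofReal_mul]
    congr 1; ring
  · rw [relEigenvalues, relEndo, hA, hB, roots_charpoly_inv_mul hQ]
    have : (fun i => (((μ ∘ σ) i : ℝ) : ℂ)) = (fun i => (μ i : ℂ)) ∘ σ := rfl
    rw [this, ← Multiset.map_map]
    congr 1
    exact (Multiset.map_univ_val_equiv σ).symm

end Pencil

/-! ### Wedge powers of a diagonal form on a complex frame -/

section WedgePower

variable {n : ℕ}

/-- Both the shuffle wedge product and `alternatization` are unnormalized, so no factorials appear.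
Iterating this turns a wedge power into one signed sum over permutations, that is, into
determinants. -/
theorem wedge_alternatization {k l : ℕ} (a : MultilinearMap ℝ (fun _ : Fin k => Fin n → ℂ) ℂ)
    (b : MultilinearMap ℝ (fun _ : Fin l => Fin n → ℂ) ℂ) :
    wedge (MultilinearMap.alternatization a) (MultilinearMap.alternatization b) =
      MultilinearMap.alternatization
        (((LinearMap.mul' ℝ ℂ).compMultilinearMap (a.domCoprod b)).domDomCongr finSumFinEquiv) := by
  rw [wedge, ← MultilinearMap.domCoprod_alternization]
  ext v
  simp only [LinearMap.compAlternatingMap_apply, AlternatingMap.domDomCongr_apply,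
    MultilinearMap.alternatization_apply, map_sum, MultilinearMap.domDomCongr_apply,
    LinearMap.compMultilinearMap_apply]
  refine Fintype.sum_equiv (Equiv.permCongr finSumFinEquiv) _ _ fun σ => ?_
  rw [Equiv.Perm.sign_permCongr]
  simp only [Units.smul_def, map_zsmul]
  congr 3
  ext i
  simp [Function.comp_apply, Equiv.permCongr_apply]

/-- The `m`-th tensor power of a bilinear form. -/
def tensorPow (β : MultilinearMap ℝ (fun _ : Fin 2 => Fin n → ℂ) ℂ) :
    (m : ℕ) → MultilinearMap ℝ (fun _ : Fin (2 * m) => Fin n → ℂ) ℂ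
  | 0 => (AlternatingMap.constOfIsEmpty ℝ (Fin n → ℂ) (Fin 0) (1 : ℂ)).toMultilinearMap
  | m + 1 => ((LinearMap.mul' ℝ ℂ).compMultilinearMap
      ((tensorPow β m).domCoprod β)).domDomCongr finSumFinEquiv

theorem wedgePow_alternatization (β : MultilinearMap ℝ (fun _ : Fin 2 => Fin n → ℂ) ℂ) (m : ℕ) :
    wedgePow (MultilinearMap.alternatization β) m =
      MultilinearMap.alternatization (tensorPow β m) := by
  induction m with
  | zero =>
    ext v
    rw [MultilinearMap.alternatization_apply]
    simp [wedgePow, tensorPow]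
  | succ m ih =>
    rw [wedgePow, ih, wedge_alternatization]
    rfl

theorem tensorPow_apply (β : MultilinearMap ℝ (fun _ : Fin 2 => Fin n → ℂ) ℂ) (m : ℕ)
    (x : Fin (2 * m) → Fin n → ℂ) :
    tensorPow β m x = ∏ k : Fin m, β ![x ⟨2 * k, by omega⟩, x ⟨2 * k + 1, by omega⟩] := by
  induction m with
  | zero => simp [tensorPow]
  | succ m ih =>
    rw [tensorPow, MultilinearMap.domDomCongr_apply, LinearMap.compMultilinearMap_apply,
      MultilinearMap.domCoprod_apply, LinearMap.mul'_apply, ih, Fin.prod_univ_castSucc]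
    congr 2
    ext i
    fin_cases i <;> rfl

/-- The enumeration `0, 2, 4, …; 1, 3, 5, …` of `Fin (2 * m)`. -/
def evenOddEquiv (m : ℕ) : Fin m ⊕ Fin m ≃ Fin (2 * m) :=
  Equiv.ofBijective
    (Sum.elim (fun k => ⟨2 * k, by omega⟩) (fun k => ⟨2 * k + 1, by omega⟩)) <| by
    rw [Fintype.bijective_iff_injective_and_card]
    constructor
    · rintro (i | i) (j | j) h <;> simp [Fin.ext_iff] at h ⊢ <;> omega
    · simp; omega

theorem evenOddEquiv_inl {m : ℕ} (k : Fin m) :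
    evenOddEquiv m (Sum.inl k) = ⟨2 * k, by omega⟩ := rfl

theorem evenOddEquiv_inr {m : ℕ} (k : Fin m) :
    evenOddEquiv m (Sum.inr k) = ⟨2 * k + 1, by omega⟩ := rfl

theorem complexFrame_inl {m : ℕ} (v : Fin m → Fin n → ℂ) (k : Fin m) :
    complexFrame v (evenOddEquiv m (Sum.inl k)) = v k := by
  simp [evenOddEquiv_inl, complexFrame]

theorem complexFrame_inr {m : ℕ} (v : Fin m → Fin n → ℂ) (k : Fin m) :
    complexFrame v (evenOddEquiv m (Sum.inr k)) = Complex.I • v k := by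
  have h1 : (2 * (k : ℕ) + 1) % 2 = 1 := by omega
  have h2 : (2 * (k : ℕ) + 1) / 2 = k := by omega
  simp [evenOddEquiv_inr, complexFrame, h1, h2]

/-- The determinant of the matrix with blocks `G, G̅, √-1 G, -√-1 G̅`. -/
theorem det_fromBlocks_conj {m : ℕ} (G : Matrix (Fin m) (Fin m) ℂ) :
    (fromBlocks G (G.map conj) (Complex.I • G) (-(Complex.I • G.map conj))).det =
      (-2 * Complex.I) ^ m * (G.det * conj G.det) := by
  -- The rows for `√-1 v` multiply the rows for `v` by `±√-1`, so a constant block matrix splits off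
  -- a block diagonal one.
  have h : fromBlocks G (G.map conj) (Complex.I • G) (-(Complex.I • G.map conj)) =
      fromBlocks 1 1 (Complex.I • 1) (-(Complex.I • 1)) * fromBlocks G 0 0 (G.map conj) := by
    rw [fromBlocks_multiply]
    simp
  have h2 : (-(Complex.I • (1 : Matrix (Fin m) (Fin m) ℂ)) - Complex.I • 1) =
      (-2 * Complex.I) • (1 : Matrix (Fin m) (Fin m) ℂ) := by
    rw [← neg_smul, ← sub_smul]; congr 1; ring
  have h3 : (G.map conj).det = conj G.det := by
    rw [RingHom.map_det]; rfl
  rw [h, det_mul, det_fromBlocks_one₁₁, det_fromBlocks_zero₂₁, Matrix.mul_one, h2, det_smul,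
    det_one, h3, mul_one, Fintype.card_fin]

/-- A bilinear form whose alternatization is `∑ⱼ cⱼ Im (L̅ⱼ ⊗ Lⱼ)`. -/
def diagBilin (c : Fin n → ℂ) (L : (Fin n → ℂ) →ₗ[ℂ] (Fin n → ℂ)) :
    MultilinearMap ℝ (fun _ : Fin 2 => Fin n → ℂ) ℂ :=
  ∑ j, (Complex.I / 2 * c j) • (MultilinearMap.mkPiAlgebra ℝ (Fin 2) ℂ).compLinearMap
    ![((LinearMap.proj j).comp L).restrictScalars ℝ,
      Complex.conjAe.toLinearMap.comp (((LinearMap.proj j).comp L).restrictScalars ℝ)]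

theorem diagBilin_apply (c : Fin n → ℂ) (L : (Fin n → ℂ) →ₗ[ℂ] (Fin n → ℂ)) (v w : Fin n → ℂ) :
    diagBilin c L ![v, w] = ∑ j, Complex.I / 2 * c j * (L v j * conj (L w j)) := by
  simp [diagBilin, Fin.prod_univ_two]

/-- With `z = conj (L v j) * L w j`, antisymmetrizing gives `(√-1 / 2) (conj z - z) = Im z`. -/
theorem alternatization_diagBilin (c : Fin n → ℂ) (L : (Fin n → ℂ) →ₗ[ℂ] (Fin n → ℂ))
    (v w : Fin n → ℂ) :
    MultilinearMap.alternatization (diagBilin c L) ![v, w] =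
      ∑ j, c j * ((conj (L v j) * L w j).im : ℂ) := by
  have h1 : (fun i => (![v, w] : Fin 2 → Fin n → ℂ) ((Equiv.swap (0 : Fin 2) 1) i)) = ![w, v] := by
    ext i; fin_cases i <;> simp
  have h2 : (fun i => (![v, w] : Fin 2 → Fin n → ℂ) ((1 : Equiv.Perm (Fin 2)) i)) = ![v, w] := rfl
  have h3 : (Finset.univ : Finset (Equiv.Perm (Fin 2))) = {1, Equiv.swap 0 1} := by decide
  rw [MultilinearMap.alternatization_apply, h3, Finset.sum_pair (by decide),
    Equiv.Perm.sign_one, Equiv.Perm.sign_swap (by decide)]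
  simp only [MultilinearMap.domDomCongr_apply, h1, h2, diagBilin_apply, one_smul, Units.neg_smul]
  rw [← Finset.sum_neg_distrib, ← Finset.sum_add_distrib]
  refine Finset.sum_congr rfl fun j _ => ?_
  have h4 := Complex.im_eq_sub_conj (conj (L v j) * L w j)
  have h5 : (2 * Complex.I)⁻¹ = -Complex.I / 2 := by
    rw [mul_inv, Complex.inv_I]; ring
  rw [h4, map_mul, Complex.conj_conj, div_eq_mul_inv _ (2 * Complex.I), h5]
  ring

/-- The powers of a diagonal form, evaluated on a complex frame. -/
theorem wedgePow_diagBilin_complexFrame (c : Fin n → ℂ) (L : (Fin n → ℂ) →ₗ[ℂ] (Fin n → ℂ))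
    {m : ℕ} (v : Fin m → Fin n → ℂ) :
    wedgePow (MultilinearMap.alternatization (diagBilin c L)) m (complexFrame v) =
      ∑ f : Fin m → Fin n, (∏ k, c (f k)) *
        (Complex.normSq (Matrix.of fun p k => L (v p) (f k)).det : ℂ) := by
  set x := complexFrame v with hx
  have hI : (Complex.I / 2) * (-2 * Complex.I) = 1 := by
    linear_combination -Complex.I_mul_I
  -- Expanding the product of the `m` factors chooses a coordinate `f k` in each. For fixed `f`, the
  -- signed sum over permutations is the determinant of `N f`, whose rows are frame vectors and
  -- whose columns are the chosen coordinates and their conjugates. Its factor `(-2√-1)ᵐ` cancels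
  -- the `(√-1/2)ᵐ` from `diagBilin`.
  let N : (Fin m → Fin n) → Matrix (Fin m ⊕ Fin m) (Fin m ⊕ Fin m) ℂ := fun f =>
    Matrix.of fun p q => Sum.elim (fun k => L (x (evenOddEquiv m p)) (f k))
      (fun k => conj (L (x (evenOddEquiv m p)) (f k))) q
  have hN : ∀ f, (N f).det =
      (-2 * Complex.I) ^ m * (Complex.normSq (Matrix.of fun p k => L (v p) (f k)).det : ℂ) := by
    intro f
    rw [← Complex.mul_conj, ← det_fromBlocks_conj]
    congr 1
    ext p q
    rcases p with p | p <;> rcases q with q | q <;>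
      simp [N, hx, complexFrame_inl, complexFrame_inr]
  have hterm : ∀ σ : Equiv.Perm (Fin m ⊕ Fin m),
      tensorPow (diagBilin c L) m
        (fun i => x (((evenOddEquiv m).permCongr σ) i)) =
      ∑ f : Fin m → Fin n, (∏ k, (Complex.I / 2 * c (f k))) * ∏ q, N f (σ q) q := by
    intro σ
    rw [tensorPow_apply]
    simp only [diagBilin_apply]
    rw [Finset.prod_univ_sum, Fintype.piFinset_univ]
    refine Finset.sum_congr rfl fun f _ => ?_
    rw [Fintype.prod_sum_type, Finset.prod_mul_distrib, Finset.prod_mul_distrib]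
    congr 1
    rw [Finset.prod_mul_distrib]
    refine congrArg₂ (fun a b : ℂ => a * b) ?_ ?_
    · refine Finset.prod_congr rfl fun k _ => ?_
      rw [← evenOddEquiv_inl]
      simp [N]
    · refine Finset.prod_congr rfl fun k _ => ?_
      rw [← evenOddEquiv_inr]
      simp [N]
  rw [wedgePow_alternatization, MultilinearMap.alternatization_apply,
    ← Equiv.sum_comp (evenOddEquiv m).permCongr]
  simp only [MultilinearMap.domDomCongr_apply, hterm, Equiv.Perm.sign_permCongr, Finset.smul_sum]
  rw [Finset.sum_comm]
  refine Finset.sum_congr rfl fun f _ => ?_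
  have hdet := det_apply (N f)
  calc ∑ σ : Equiv.Perm (Fin m ⊕ Fin m),
        Equiv.Perm.sign σ • ((∏ k, (Complex.I / 2 * c (f k))) * ∏ q, N f (σ q) q)
      = (∏ k, (Complex.I / 2 * c (f k))) * (N f).det := by
        rw [hdet, Finset.mul_sum]
        exact Finset.sum_congr rfl fun σ _ => (mul_smul_comm _ _ _).symm
    _ = _ := by
        rw [hN, Finset.prod_mul_distrib, Finset.prod_const, Finset.card_univ, Fintype.card_fin]
        calc _ = ((Complex.I / 2) * (-2 * Complex.I)) ^ m * ((∏ k, c (f k)) *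
              (Complex.normSq (Matrix.of fun p k => L (v p) (f k)).det : ℂ)) := by
              rw [mul_pow (Complex.I / 2)]
              simp only [mul_assoc, mul_left_comm]
          _ = _ := by rw [hI, one_pow, one_mul]

end WedgePower

/-! ### Strict positivity in terms of eigenvalues -/

section Positivity

variable {n : ℕ}

theorem one_add_mul_I_eq (t : ℝ) : (1 + t * Complex.I : ℂ) =
    Real.sqrt (1 + t ^ 2) * Complex.exp (Real.arctan t * Complex.I) := by
  have h0 : (0 : ℝ) < Real.sqrt (1 + t ^ 2) := Real.sqrt_pos.2 (by positivity)
  rw [Complex.exp_mul_I, ← Complex.ofReal_cos, ← Complex.ofReal_sin, Real.cos_arctan,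
    Real.sin_arctan]
  apply Complex.ext
  · simp [mul_inv_cancel₀ h0.ne']
  · simp [mul_div_cancel₀ _ h0.ne']

theorem exp_mul_prod_re {ι : Type*} (s : Finset ι) (t : ι → ℝ) (θ : ℝ) :
    (Complex.exp (-(θ * Complex.I)) * ∏ k ∈ s, (1 + t k * Complex.I : ℂ)).re =
      (∏ k ∈ s, Real.sqrt (1 + t k ^ 2)) * Real.cos (∑ k ∈ s, Real.arctan (t k) - θ) := by
  have h : Complex.exp (-(θ * Complex.I)) * ∏ k ∈ s, (1 + t k * Complex.I : ℂ) =
      ((∏ k ∈ s, Real.sqrt (1 + t k ^ 2) : ℝ) : ℂ) *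
        Complex.exp ((∑ k ∈ s, Real.arctan (t k) - θ : ℝ) * Complex.I) := by
    simp only [one_add_mul_I_eq, Finset.prod_mul_distrib, ← Complex.exp_sum]
    rw [mul_left_comm, ← Complex.exp_add]
    push_cast
    rw [sub_mul, Finset.sum_mul]
    congr 2
    ring
  rw [h, Complex.re_ofReal_mul, Complex.exp_ofReal_mul_I_re]

theorem Diagonalizes.addI_eq {a b : (Fin n → ℂ) [⋀^Fin 2]→L[ℝ] ℝ} {μ : Fin n → ℝ}
    {L : (Fin n → ℂ) ≃ₗ[ℂ] (Fin n → ℂ)} (D : Diagonalizes a b μ L) :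
    addI a b = MultilinearMap.alternatization
      (diagBilin (fun j => 1 + μ j * Complex.I) (L : (Fin n → ℂ) →ₗ[ℂ] (Fin n → ℂ))) := by
  ext x
  have hx : x = ![x 0, x 1] := by ext i; fin_cases i <;> rfl
  rw [hx, alternatization_diagBilin]
  have h : addI a b ![x 0, x 1] = (a ![x 0, x 1] : ℂ) + Complex.I * (b ![x 0, x 1] : ℂ) := rfl
  rw [h, D.left, D.right]
  push_cast
  rw [Finset.mul_sum, ← Finset.sum_add_distrib]
  refine Finset.sum_congr rfl fun j _ => ?_
  change _ = _ * (((starRingEnd ℂ) (L (x 0) j) * L (x 1) j).im : ℂ)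
  ring

theorem sum_comp_eq_sub {m : ℕ} {f : Fin m → Fin (m + 1)} (hf : Function.Injective f)
    {i : Fin (m + 1)} (hi : ∀ k, f k ≠ i) (g : Fin (m + 1) → ℝ) :
    ∑ k, g (f k) = ∑ j, g j - g i := by
  have h : Finset.univ.image f = Finset.univ.erase i := by
    refine Finset.eq_of_subset_of_card_le (fun j hj => ?_) ?_
    · obtain ⟨k, -, rfl⟩ := Finset.mem_image.1 hj
      exact Finset.mem_erase.2 ⟨hi k, Finset.mem_univ _⟩
    · rw [Finset.card_image_of_injective _ hf, Finset.card_erase_of_mem (Finset.mem_univ i)]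
      simp
  rw [← Finset.add_sum_erase _ g (Finset.mem_univ i), add_sub_cancel_left, ← h,
    Finset.sum_image hf.injOn]

theorem exists_forall_ne {m : ℕ} (f : Fin m → Fin (m + 1)) : ∃ i, ∀ k, f k ≠ i := by
  by_contra! h
  have := Fintype.card_le_of_surjective f h
  simp at this

theorem injective_of_det_ne_zero {m : ℕ} {w : Fin m → Fin n → ℂ} {f : Fin m → Fin n}
    (h : (Matrix.of fun p k => w p (f k)).det ≠ 0) : Function.Injective f := by
  intro k l hkl
  by_contra hne
  exact h (det_zero_of_column_eq hne fun p => by simp [hkl])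

/-- Linearly independent vectors have a non-vanishing maximal minor. -/
theorem exists_det_ne_zero {m : ℕ} {w : Fin m → Fin n → ℂ} (hw : LinearIndependent ℂ w) :
    ∃ f : Fin m → Fin n, (Matrix.of fun p k => w p (f k)).det ≠ 0 := by
  set W : Matrix (Fin m) (Fin n) ℂ := Matrix.of w with hW
  have hr : W.rank = m := by
    have := LinearIndependent.rank_matrix (M := W) hw
    simpa using this
  have hfin : Module.finrank ℂ (Submodule.span ℂ (Set.range W.col)) = m := by
    -- Row rank equals column rank, so `m` of the columns are independent and span the column space;
    -- these give the minor.
    rw [← Matrix.rank_eq_finrank_span_cols, hr]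
  obtain ⟨g, hg1, -, hg3⟩ := Submodule.exists_fun_fin_finrank_span_eq ℂ (Set.range W.col)
  choose f hf using hg1
  have hli : LinearIndependent ℂ (fun k : Fin m => W.col (f (Fin.cast hfin.symm k))) := by
    have := hg3.comp (Fin.cast hfin.symm) (Fin.cast_injective _)
    have e : (fun k : Fin m => W.col (f (Fin.cast hfin.symm k))) = g ∘ Fin.cast hfin.symm :=
      funext fun k => hf _
    rw [e]
    exact this
  refine ⟨fun k => f (Fin.cast hfin.symm k), ?_⟩
  rw [← det_transpose]
  have := (Matrix.linearIndependent_rows_iff_isUnit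
    (A := Matrix.of fun k p => w p (f (Fin.cast hfin.symm k)))).1 hli
  exact ((Matrix.isUnit_iff_isUnit_det _).1 this).ne_zero

theorem linearIndependent_symm_single_succAbove {m : ℕ}
    (L : (Fin (m + 1) → ℂ) ≃ₗ[ℂ] (Fin (m + 1) → ℂ)) (i : Fin (m + 1)) :
    LinearIndependent ℂ fun p : Fin m =>
      L.symm (Pi.single (i.succAbove p) (1 : ℂ) : Fin (m + 1) → ℂ) := by
  have h1 : LinearIndependent ℂ fun j : Fin (m + 1) => L.symm (Pi.single j (1 : ℂ)) := by
    have h := ((Pi.basisFun ℂ (Fin (m + 1))).map L.symm).linearIndependent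
    have e : (fun j : Fin (m + 1) => L.symm (Pi.single j (1 : ℂ))) =
        ⇑((Pi.basisFun ℂ (Fin (m + 1))).map L.symm) := by
      funext j
      rw [Module.Basis.map_apply, Pi.basisFun_apply]
    rw [e]
    exact h
  exact h1.comp _ (Fin.succAbove_right_injective (p := i))

theorem linearIndependent_map_equiv {m : ℕ} {v : Fin m → Fin n → ℂ} (hv : LinearIndependent ℂ v)
    (L : (Fin n → ℂ) ≃ₗ[ℂ] (Fin n → ℂ)) : LinearIndependent ℂ fun p => L (v p) :=
  hv.map' (L : (Fin n → ℂ) →ₗ[ℂ] (Fin n → ℂ)) (LinearEquiv.ker L)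

/-- Strict positivity of `Re (exp (-√-1 θ) (a + √-1 b)ᵐ)` in dimension `m + 1`, in terms of the
eigenvalues. -/
theorem Diagonalizes.isStrictlyPositive_iff {m : ℕ}
    {a b : (Fin (m + 1) → ℂ) [⋀^Fin 2]→L[ℝ] ℝ} {μ : Fin (m + 1) → ℝ}
    {L : (Fin (m + 1) → ℂ) ≃ₗ[ℂ] (Fin (m + 1) → ℂ)} (D : Diagonalizes a b μ L) {κ θ : ℝ}
    (hκ : 0 < κ) {η : (Fin (m + 1) → ℂ) [⋀^Fin (2 * m)]→ₗ[ℝ] ℂ}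
    (hη : ∀ y, η y =
      ((κ * (Complex.exp (-(θ * Complex.I)) * wedgePow (addI a b) m y).re : ℝ) : ℂ)) :
    IsStrictlyPositive η ↔ ∀ i, 0 < Real.cos (arctanSum μ - Real.arctan (μ i) - θ) := by
  let P : (Fin m → Fin (m + 1)) → ℝ := fun f => ∏ k, Real.sqrt (1 + μ (f k) ^ 2)
  have hP : ∀ f, 0 < P f := fun f =>
    Finset.prod_pos fun k _ => Real.sqrt_pos.2 (by positivity)
  let Δ : (Fin m → Fin (m + 1) → ℂ) → (Fin m → Fin (m + 1)) → ℂ := fun v f =>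
    (Matrix.of fun p k => L (v p) (f k)).det
  have key : ∀ v : Fin m → Fin (m + 1) → ℂ,
      (Complex.exp (-(θ * Complex.I)) * wedgePow (addI a b) m (complexFrame v)).re =
      ∑ f : Fin m → Fin (m + 1), P f * Real.cos (∑ k, Real.arctan (μ (f k)) - θ) *
        Complex.normSq (Δ v f) := by
    intro v
    rw [D.addI_eq, wedgePow_diagBilin_complexFrame, Finset.mul_sum, Complex.re_sum]
    refine Finset.sum_congr rfl fun f _ => ?_
    rw [← mul_assoc, Complex.re_mul_ofReal, exp_mul_prod_re]
    rfl
  have hpos : IsStrictlyPositive η ↔ ∀ v : Fin m → Fin (m + 1) → ℂ, LinearIndependent ℂ v →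
      0 < ∑ f : Fin m → Fin (m + 1), P f * Real.cos (∑ k, Real.arctan (μ (f k)) - θ) *
        Complex.normSq (Δ v f) := by
    refine forall₂_congr fun v _ => ?_
    rw [hη, Complex.ofReal_re, Complex.ofReal_im, key, and_iff_left rfl, mul_pos_iff_of_pos_left hκ]
  rw [hpos]
  constructor
  · intro h i
    -- Test on the hyperplane where the `i`-th coordinate vanishes: only the `f` that avoid `i` have
    -- nonzero minors, so every surviving term carries the same cosine.
    let v : Fin m → Fin (m + 1) → ℂ := fun p => L.symm (Pi.single (i.succAbove p) 1)
    have hv : LinearIndependent ℂ v := linearIndependent_symm_single_succAbove L i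
    have hsum : ∑ f : Fin m → Fin (m + 1), P f * Real.cos (∑ k, Real.arctan (μ (f k)) - θ) *
        Complex.normSq (Δ v f) =
        Real.cos (arctanSum μ - Real.arctan (μ i) - θ) *
          ∑ f : Fin m → Fin (m + 1), P f * Complex.normSq (Δ v f) := by
      rw [Finset.mul_sum]
      refine Finset.sum_congr rfl fun f _ => ?_
      by_cases hf : Δ v f = 0
      · simp [hf]
      · have hinj : Function.Injective f := injective_of_det_ne_zero hf
        have hi : ∀ k, f k ≠ i := by
          intro k hk
          refine hf (det_eq_zero_of_column_eq_zero k fun p => ?_)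
          simp [v, hk]
        rw [sum_comp_eq_sub hinj hi fun j => Real.arctan (μ j), arctanSum]
        ring
    have h3 := h v hv
    rw [hsum] at h3
    exact pos_of_mul_pos_left h3
      (Finset.sum_nonneg fun f _ => mul_nonneg (hP f).le (Complex.normSq_nonneg _))
  · intro h v hv
    -- A nonzero minor forces `f` to be injective; it then misses exactly one index, and its phase
    -- is the corresponding partial sum.
    have hc : ∀ f, Δ v f ≠ 0 → 0 < Real.cos (∑ k, Real.arctan (μ (f k)) - θ) := by
      intro f hf
      obtain ⟨i, hi⟩ := exists_forall_ne f
      rw [sum_comp_eq_sub (injective_of_det_ne_zero hf) hi fun j => Real.arctan (μ j)]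
      exact h i
    obtain ⟨f, hf⟩ := exists_det_ne_zero (linearIndependent_map_equiv hv L)
    refine Finset.sum_pos' (fun g _ => ?_) ⟨f, Finset.mem_univ f, ?_⟩
    · by_cases hg : Δ v g = 0
      · simp [hg]
      · exact mul_nonneg (mul_pos (hP g) (hc g hg)).le (Complex.normSq_nonneg _)
    · exact mul_pos (mul_pos (hP f) (hc f hf)) (Complex.normSq_pos.2 hf)

end Positivity

/-! ### Min-max characterization and stability of eigenvalues -/

section MinMax

variable {n : ℕ}

/-- `b - t a` is positive definite on a complex subspace of dimension at least `k`. -/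
def ExceedsOn (a b : (Fin n → ℂ) [⋀^Fin 2]→L[ℝ] ℝ) (t : ℝ) (k : ℕ) : Prop :=
  ∃ W : Submodule ℂ (Fin n → ℂ), k ≤ Module.finrank ℂ W ∧
    ∀ v ∈ W, v ≠ 0 → t * a ![v, Complex.I • v] < b ![v, Complex.I • v]

theorem exists_submodule_coord_zero (L : (Fin n → ℂ) ≃ₗ[ℂ] (Fin n → ℂ)) (p : Fin n → Prop)
    [DecidablePred p] :
    ∃ W : Submodule ℂ (Fin n → ℂ), n ≤ Module.finrank ℂ W + Fintype.card {j // p j} ∧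
      ∀ v ∈ W, ∀ j, p j → L v j = 0 := by
  let F : (Fin n → ℂ) →ₗ[ℂ] ({j // p j} → ℂ) :=
    (LinearMap.funLeft ℂ ℂ Subtype.val).comp (L : (Fin n → ℂ) →ₗ[ℂ] (Fin n → ℂ))
  refine ⟨LinearMap.ker F, ?_, fun v hv j hj => ?_⟩
  · have h1 := LinearMap.finrank_range_add_finrank_ker F
    have h2 := Submodule.finrank_le (LinearMap.range F)
    rw [Module.finrank_fintype_fun_eq_card] at h1 h2
    rw [Fintype.card_fin] at h1
    omega
  · exact congrFun (LinearMap.mem_ker.1 hv) ⟨j, hj⟩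

theorem exists_ne_zero_mem_of_finrank {W W' : Submodule ℂ (Fin n → ℂ)}
    (h : n < Module.finrank ℂ W + Module.finrank ℂ W') : ∃ v ∈ W, v ∈ W' ∧ v ≠ 0 := by
  have h1 := Submodule.finrank_sup_add_finrank_inf_eq W W'
  have h2 := Submodule.finrank_le (W ⊔ W')
  rw [Module.finrank_fintype_fun_eq_card, Fintype.card_fin] at h2
  have h3 : W ⊓ W' ≠ ⊥ := by
    intro h4
    rw [h4, finrank_bot] at h1
    omega
  obtain ⟨v, hv, hv0⟩ := Submodule.exists_mem_ne_zero_of_ne_bot h3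
  exact ⟨v, hv.1, hv.2, hv0⟩

variable {a b : (Fin n → ℂ) [⋀^Fin 2]→L[ℝ] ℝ} {μ : Fin n → ℝ}
  {L : (Fin n → ℂ) ≃ₗ[ℂ] (Fin n → ℂ)}

theorem conj_mul_I_mul_im (z : ℂ) : (conj z * (Complex.I * z)).im = Complex.normSq z := by
  simp [Complex.normSq_apply]

theorem Diagonalizes.sub_eq (D : Diagonalizes a b μ L) (t : ℝ) (v : Fin n → ℂ) :
    b ![v, Complex.I • v] - t * a ![v, Complex.I • v] =
      ∑ j, (μ j - t) * Complex.normSq (L v j) := by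
  rw [D.left, D.right, Finset.mul_sum, ← Finset.sum_sub_distrib]
  refine Finset.sum_congr rfl fun j _ => ?_
  rw [map_smul, Pi.smul_apply, smul_eq_mul, conj_mul_I_mul_im]
  ring

theorem exists_coord_ne_zero (L : (Fin n → ℂ) ≃ₗ[ℂ] (Fin n → ℂ)) {v : Fin n → ℂ} (hv : v ≠ 0) :
    ∃ j, L v j ≠ 0 := by
  by_contra! h
  exact hv (L.map_eq_zero_iff.1 (funext h))

/-- Courant–Fischer by dimension count: a subspace of dimension `k + 1` meets the one where the
first `k` coordinates vanish, and there `b - t a ≤ 0` if `μ k ≤ t`. Indices start at `0`, so `μ k`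
is the `(k + 1)`-st largest eigenvalue. -/
theorem Diagonalizes.lt_of_exceedsOn (D : Diagonalizes a b μ L) {t : ℝ} {k : Fin n}
    (h : ExceedsOn a b t (k + 1)) : t < μ k := by
  by_contra! hk
  obtain ⟨W, hW, hpos⟩ := h
  obtain ⟨W', hW', hz⟩ := exists_submodule_coord_zero L (fun j => j < k)
  have hcard : Fintype.card {j : Fin n // j < k} = k := by
    rw [Fintype.card_subtype, Finset.filter_gt_eq_Iio, Fin.card_Iio]
  obtain ⟨v, hv, hv', hv0⟩ := exists_ne_zero_mem_of_finrank (W := W) (W' := W') (by omega)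
  have h1 := sub_pos.2 (hpos v hv hv0)
  rw [D.sub_eq] at h1
  refine absurd h1 (not_lt.2 (Finset.sum_nonpos fun j _ => ?_))
  rcases lt_or_ge j k with hj | hj
  · simp [hz v hv' j hj]
  · exact mul_nonpos_of_nonpos_of_nonneg (sub_nonpos.2 ((D.antitone hj).trans hk))
      (Complex.normSq_nonneg _)

theorem Diagonalizes.exceedsOn (D : Diagonalizes a b μ L) {t : ℝ} {k : Fin n} (h : t < μ k) :
    ExceedsOn a b t (k + 1) := by
  obtain ⟨W, hW, hz⟩ := exists_submodule_coord_zero L (fun j => k < j)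
  have hcard : Fintype.card {j : Fin n // k < j} = n - 1 - k := by
    rw [Fintype.card_subtype, Finset.filter_lt_eq_Ioi, Fin.card_Ioi]
  refine ⟨W, by omega, fun v hv hv0 => sub_pos.1 ?_⟩
  rw [D.sub_eq]
  have hpos : ∀ j, L v j ≠ 0 → 0 < (μ j - t) * Complex.normSq (L v j) := fun j hj => by
    have hjk : j ≤ k := not_lt.1 fun hlt => hj (hz v hv j hlt)
    exact mul_pos (sub_pos.2 (h.trans_le (D.antitone hjk))) (Complex.normSq_pos.2 hj)
  obtain ⟨j, hj⟩ := exists_coord_ne_zero L hv0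
  refine Finset.sum_pos' (fun i _ => ?_) ⟨j, Finset.mem_univ j, hpos j hj⟩
  by_cases hi : L v i = 0
  · simp [hi]
  · exact (hpos i hi).le

/-- The min-max principle. -/
theorem Diagonalizes.exceedsOn_iff (D : Diagonalizes a b μ L) {t : ℝ} {k : Fin n} :
    ExceedsOn a b t (k + 1) ↔ t < μ k := ⟨D.lt_of_exceedsOn, D.exceedsOn⟩

/-- `ExceedsOn` is an open condition, so by itself it gives only lower semicontinuity of the
eigenvalues; this version for `-b` supplies upper semicontinuity. The `n - k` coordinates from `k`
onward span the witness. -/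
theorem Diagonalizes.exceedsOn_neg_iff (D : Diagonalizes a b μ L) {t : ℝ} {k : Fin n} :
    ExceedsOn a (-b) (-t) (n - k) ↔ μ k < t := by
  have hsub : ∀ v, (-b) ![v, Complex.I • v] - -t * a ![v, Complex.I • v] =
      ∑ j, (t - μ j) * Complex.normSq (L v j) := fun v => by
    have h := D.sub_eq t v
    have e : ∑ j, (t - μ j) * Complex.normSq (L v j) =
        -∑ j, (μ j - t) * Complex.normSq (L v j) := by
      rw [← Finset.sum_neg_distrib]
      exact Finset.sum_congr rfl fun j _ => by ring
    rw [e, ← h, ContinuousAlternatingMap.neg_apply]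
    ring
  constructor
  · rintro ⟨W, hW, hpos⟩
    by_contra! hk
    obtain ⟨W', hW', hz⟩ := exists_submodule_coord_zero L (fun j => k < j)
    have hcard : Fintype.card {j : Fin n // k < j} = n - 1 - k := by
      rw [Fintype.card_subtype, Finset.filter_lt_eq_Ioi, Fin.card_Ioi]
    have hkn := k.isLt
    obtain ⟨v, hv, hv', hv0⟩ := exists_ne_zero_mem_of_finrank (W := W) (W' := W') (by omega)
    have h1 := sub_pos.2 (hpos v hv hv0)
    rw [hsub] at h1
    refine absurd h1 (not_lt.2 (Finset.sum_nonpos fun j _ => ?_))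
    rcases lt_or_ge k j with hj | hj
    · simp [hz v hv' j hj]
    · exact mul_nonpos_of_nonpos_of_nonneg (sub_nonpos.2 (hk.trans (D.antitone hj)))
        (Complex.normSq_nonneg _)
  · intro h
    obtain ⟨W, hW, hz⟩ := exists_submodule_coord_zero L (fun j => j < k)
    have hcard : Fintype.card {j : Fin n // j < k} = k := by
      rw [Fintype.card_subtype, Finset.filter_gt_eq_Iio, Fin.card_Iio]
    refine ⟨W, by omega, fun v hv hv0 => sub_pos.1 ?_⟩
    rw [hsub]
    have hpos : ∀ j, L v j ≠ 0 → 0 < (t - μ j) * Complex.normSq (L v j) := fun j hj => by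
      have hjk : k ≤ j := not_lt.1 fun hlt => hj (hz v hv j hlt)
      exact mul_pos (sub_pos.2 ((D.antitone hjk).trans_lt h)) (Complex.normSq_pos.2 hj)
    obtain ⟨j, hj⟩ := exists_coord_ne_zero L hv0
    refine Finset.sum_pos' (fun i _ => ?_) ⟨j, Finset.mem_univ j, hpos j hj⟩
    by_cases hi : L v i = 0
    · simp [hi]
    · exact (hpos i hi).le

/-- Monotonicity of the eigenvalues. -/
theorem Diagonalizes.le_of_le (D : Diagonalizes a b μ L) {b' : (Fin n → ℂ) [⋀^Fin 2]→L[ℝ] ℝ}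
    {μ' : Fin n → ℝ} {L' : (Fin n → ℂ) ≃ₗ[ℂ] (Fin n → ℂ)} (D' : Diagonalizes a b' μ' L')
    (h : ∀ v, b ![v, Complex.I • v] ≤ b' ![v, Complex.I • v]) (k : Fin n) : μ k ≤ μ' k := by
  refine le_of_forall_lt fun t ht => D'.exceedsOn_iff.1 ?_
  obtain ⟨W, hW, hpos⟩ := D.exceedsOn ht
  exact ⟨W, hW, fun v hv hv0 => (hpos v hv hv0).trans_le (h v)⟩

/-- Subspaces are carried along by the isomorphism `M`. This invariance matters because forms at
different points are written in different preferred charts, and only their expressions in one fixed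
chart vary continuously. -/
theorem exceedsOn_comp_iff (a b : (Fin n → ℂ) [⋀^Fin 2]→L[ℝ] ℝ) (t : ℝ) (k : ℕ)
    (M : (Fin n → ℂ) →L[ℂ] (Fin n → ℂ)) (hM : Function.Injective M) :
    ExceedsOn (a.compContinuousLinearMap (M.restrictScalars ℝ))
      (b.compContinuousLinearMap (M.restrictScalars ℝ)) t k ↔ ExceedsOn a b t k := by
  let E : (Fin n → ℂ) ≃ₗ[ℂ] (Fin n → ℂ) := LinearEquiv.ofInjectiveEndo (M : _ →ₗ[ℂ] _) hM
  have hE : ∀ v, E v = M v := fun v => rfl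
  have happ : ∀ (c : (Fin n → ℂ) [⋀^Fin 2]→L[ℝ] ℝ) v,
      c.compContinuousLinearMap (M.restrictScalars ℝ) ![v, Complex.I • v] =
        c ![E v, Complex.I • E v] := fun c v => by
    rw [ContinuousAlternatingMap.compContinuousLinearMap_apply]
    congr 1
    ext i
    fin_cases i <;> simp [hE]
  simp only [ExceedsOn, happ]
  constructor
  · rintro ⟨W, hW, h⟩
    refine ⟨W.map (E : _ →ₗ[ℂ] _), by rwa [LinearEquiv.finrank_map_eq], ?_⟩
    rintro _ ⟨v, hv, rfl⟩ hv0
    exact h v hv fun h0 => hv0 (by rw [h0, map_zero])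
  · rintro ⟨W, hW, h⟩
    refine ⟨W.map (E.symm : _ →ₗ[ℂ] _), by rwa [LinearEquiv.finrank_map_eq], ?_⟩
    rintro _ ⟨v, hv, rfl⟩ hv0
    have hv1 : v ≠ 0 := fun h0 => hv0 (by rw [h0, map_zero])
    simpa using h v hv hv1

/-- The same `W` works nearby: the strict inequality is stable on the compact unit sphere of `W`,
and scaling extends it to all nonzero vectors. -/
theorem ExceedsOn.eventually {Y : Type*} [TopologicalSpace Y] {y₀ : Y}
    {A B : Y → (Fin n → ℂ) [⋀^Fin 2]→L[ℝ] ℝ} (hA : ContinuousAt A y₀) (hB : ContinuousAt B y₀)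
    {t : ℝ} {k : ℕ} (h : ExceedsOn (A y₀) (B y₀) t k) :
    ∀ᶠ y in nhds y₀, ExceedsOn (A y) (B y) t k := by
  obtain ⟨W, hW, hpos⟩ := h
  have hK : IsCompact (Metric.sphere (0 : Fin n → ℂ) 1 ∩ (W : Set (Fin n → ℂ))) :=
    (isCompact_sphere _ _).inter_right W.closed_of_finiteDimensional
  have hpair : Continuous fun v : Fin n → ℂ => ![v, Complex.I • v] := by
    refine continuous_pi fun i => ?_
    fin_cases i
    · exact continuous_id
    · exact continuous_const_smul _
  have hev : ∀ (C : Y → (Fin n → ℂ) [⋀^Fin 2]→L[ℝ] ℝ), ContinuousAt C y₀ → ∀ v : Fin n → ℂ,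
      ContinuousAt (fun z : Y × (Fin n → ℂ) => C z.1 ![z.2, Complex.I • z.2]) (y₀, v) := by
    intro C hC v
    have h1 : ContinuousAt (fun z : Y × (Fin n → ℂ) => C z.1) (y₀, v) :=
      ContinuousAt.comp (f := Prod.fst) (x := (y₀, v)) hC continuousAt_fst
    have h2 : ContinuousAt (fun z : Y × (Fin n → ℂ) => ![z.2, Complex.I • z.2]) (y₀, v) :=
      (hpair.comp continuous_snd).continuousAt
    exact h1.eval h2
  have hnear : ∀ᶠ y in nhds y₀, ∀ v ∈ Metric.sphere (0 : Fin n → ℂ) 1 ∩ (W : Set (Fin n → ℂ)),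
      t * A y ![v, Complex.I • v] < B y ![v, Complex.I • v] := by
    refine hK.eventually_forall_of_forall_eventually fun v hv => ?_
    have hv0 : v ≠ 0 := by
      rintro rfl
      simpa using hv.1
    exact ((hev A hA v).const_mul t).eventually_lt (hev B hB v) (hpos v hv.2 hv0)
  filter_upwards [hnear] with y hy
  refine ⟨W, hW, fun v hv hv0 => ?_⟩
  have hr : 0 < ‖v‖ := norm_pos_iff.2 hv0
  set w : Fin n → ℂ := (‖v‖⁻¹ : ℝ) • v with hw
  have hwW : w ∈ W := by
    rw [hw, ← Complex.coe_smul]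
    exact W.smul_mem _ hv
  have hw1 : w ∈ Metric.sphere (0 : Fin n → ℂ) 1 := by
    rw [mem_sphere_zero_iff_norm, hw, norm_smul, norm_inv, norm_norm, inv_mul_cancel₀ hr.ne']
  have h3 := hy w ⟨hw1, hwW⟩
  have h4 : ∀ c : (Fin n → ℂ) [⋀^Fin 2]→L[ℝ] ℝ,
      c ![w, Complex.I • w] = (‖v‖⁻¹ * ‖v‖⁻¹) * c ![v, Complex.I • v] := fun c => by
    rw [hw, smul_comm, twoForm_smul_left, twoForm_smul_right, mul_assoc]
  rw [h4, h4, mul_left_comm] at h3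
  exact lt_of_mul_lt_mul_left h3 (by positivity)

end MinMax

/-! ### Second derivatives at a local maximum -/

section SecondDerivative

variable {E : Type*} [NormedAddCommGroup E] [NormedSpace ℝ E]

/-- A positive second derivative would make the point a local minimum too, hence `g` locally
constant with zero second derivative. -/
theorem deriv_deriv_nonpos_of_isLocalMax {g : ℝ → ℝ} {t : ℝ} (hg : ContinuousAt g t)
    (hmax : IsLocalMax g t) : deriv (deriv g) t ≤ 0 := by
  by_contra! hpos
  have hmin := isLocalMin_of_deriv_deriv_pos hpos hmax.deriv_eq_zero hg
  have hconst : g =ᶠ[nhds t] fun _ => g t := by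
    filter_upwards [hmin, hmax] with s h1 h2 using le_antisymm h2 h1
  have h2 : deriv (deriv g) t = 0 := by
    rw [hconst.deriv.deriv_eq]
    simp
  exact hpos.ne' h2

theorem fderiv_fderiv_nonpos_of_isLocalMax {f : E → ℝ} {p : E} (hf : ContDiffAt ℝ 2 f p)
    (hmax : IsLocalMax f p) (v : E) : fderiv ℝ (fderiv ℝ f) p v v ≤ 0 := by
  set γ : ℝ → E := fun t => p + t • v with hγ
  have hγ0 : γ 0 = p := by simp [hγ]
  have hγd : ∀ t, HasDerivAt γ v t := fun t => by
    have h := ((hasDerivAt_id t).smul_const v).const_add p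
    rw [one_smul] at h
    exact h
  have hγc : ContinuousAt γ 0 := (hγd 0).continuousAt
  have hγt : Filter.Tendsto γ (nhds 0) (nhds p) := by
    have h := hγc.tendsto
    rwa [hγ0] at h
  have hd : ∀ᶠ t in nhds (0 : ℝ), deriv (f ∘ γ) t = fderiv ℝ f (γ t) v := by
    have h1 : ∀ᶠ q in nhds p, DifferentiableAt ℝ f q :=
      (hf.eventually (by simp)).mono fun q hq => hq.differentiableAt (by simp)
    filter_upwards [hγt.eventually h1] with t ht
    exact (ht.hasFDerivAt.comp_hasDerivAt t (hγd t)).deriv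
  have hdd : deriv (deriv (f ∘ γ)) 0 = fderiv ℝ (fderiv ℝ f) p v v := by
    rw [Filter.EventuallyEq.deriv_eq hd]
    have h2 : DifferentiableAt ℝ (fderiv ℝ f) (γ 0) := by
      rw [hγ0]
      exact (hf.fderiv_right (m := 1) (by norm_num)).differentiableAt (by simp)
    have h3 := (h2.hasFDerivAt.comp_hasDerivAt (0 : ℝ) (hγd 0)).clm_apply
      (hasDerivAt_const (0 : ℝ) v)
    rw [hγ0] at h3
    simpa using h3.deriv
  rw [← hdd]
  refine deriv_deriv_nonpos_of_isLocalMax ?_ ?_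
  · exact ContinuousAt.comp (by rw [hγ0]; exact hf.continuousAt) hγc
  · have h4 := hγt.eventually hmax
    filter_upwards [h4] with t ht
    simpa [hγ0] using ht

theorem fderiv_fderiv_le_of_isLocalMax_sub {f g : E → ℝ} {p : E} (hf : ContDiffAt ℝ 2 f p)
    (hg : ContDiffAt ℝ 2 g p) (hmax : IsLocalMax (fun x => f x - g x) p) (v : E) :
    fderiv ℝ (fderiv ℝ f) p v v ≤ fderiv ℝ (fderiv ℝ g) p v v := by
  have h := fderiv_fderiv_nonpos_of_isLocalMax (hf.sub hg) hmax v
  have hev : ∀ {k : E → ℝ}, ContDiffAt ℝ 2 k p → ∀ᶠ q in nhds p, DifferentiableAt ℝ k q :=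
    fun hk => (hk.eventually (by simp)).mono fun q hq => hq.differentiableAt (by simp)
  have hdd : ∀ {k : E → ℝ}, ContDiffAt ℝ 2 k p → DifferentiableAt ℝ (fderiv ℝ k) p :=
    fun hk => (hk.fderiv_right (m := 1) (by norm_num)).differentiableAt (by simp)
  have heq : fderiv ℝ (fun x => f x - g x) =ᶠ[nhds p] fun x => fderiv ℝ f x - fderiv ℝ g x := by
    filter_upwards [hev hf, hev hg] with q h1 h2
    exact fderiv_fun_sub h1 h2
  rw [heq.fderiv_eq, fderiv_fun_sub (hdd hf) (hdd hg)] at h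
  simpa using h

end SecondDerivative

/-! ### Passing between charts; continuity of eigenvalues on the manifold -/

section Chart

variable {n : ℕ} {X : Type*} [TopologicalSpace X] [ChartedSpace (Fin n → ℂ) X]

theorem contDiffAt_comp_chart_symm {u : X → ℝ} (hu : ContMDiff 𝓘(ℝ, Fin n → ℂ) 𝓘(ℝ, ℝ) ∞ u)
    (x : X) : ContDiffAt ℝ 2 (fun y => u ((chartAt (Fin n → ℂ) x).symm y))
      (chartAt (Fin n → ℂ) x x) := by
  have h := (contMDiffAt_iff.1 (hu x)).2
  simp only [mfld_simps] at h
  rw [contDiffWithinAt_univ] at h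
  exact h.of_le (WithTop.coe_le_coe.2 (le_top : (2 : ℕ∞) ≤ ⊤))

/-- At a maximum of `u - w` one has `√-1 ∂∂̄ u ≤ √-1 ∂∂̄ w`. -/
theorem ddbar_le_of_isMax {u w : X → ℝ} (hu : ContMDiff 𝓘(ℝ, Fin n → ℂ) 𝓘(ℝ, ℝ) ∞ u)
    (hw : ContMDiff 𝓘(ℝ, Fin n → ℂ) 𝓘(ℝ, ℝ) ∞ w) {x : X} (hmax : ∀ y, u y - w y ≤ u x - w x)
    (v : Fin n → ℂ) : ddbar u x v (Complex.I • v) ≤ ddbar w x v (Complex.I • v) := by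
  have hx : (chartAt (Fin n → ℂ) x).symm (chartAt (Fin n → ℂ) x x) = x :=
    (chartAt (Fin n → ℂ) x).left_inv (mem_chart_source _ x)
  have hm : IsLocalMax (fun y => u ((chartAt (Fin n → ℂ) x).symm y) -
      w ((chartAt (Fin n → ℂ) x).symm y)) (chartAt (Fin n → ℂ) x x) :=
    Filter.Eventually.of_forall fun y => by
      simp only [hx]
      exact hmax _
  have h := fderiv_fderiv_le_of_isLocalMax_sub (contDiffAt_comp_chart_symm hu x)
    (contDiffAt_comp_chart_symm hw x) hm
  have h1 := h v
  have h2 := h (Complex.I • v)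
  -- On the pair `(v, √-1 v)`, `ddbar` is the average of the second derivatives along `v` and `√-1
  -- v`.
  simp only [ddbar, I_smul_I_smul, map_smul, smul_eq_mul]
  linarith

/-- By the chain rule, the derivative of the reverse transition map is a left inverse. -/
theorem chartDeriv_injective [IsManifold 𝓘(ℂ, Fin n → ℂ) ω X] (x : X) {y : Fin n → ℂ}
    (hy : y ∈ (chartAt (Fin n → ℂ) x).target) :
    Function.Injective (chartDeriv (chartAt (Fin n → ℂ) x) y) := by
  set e := chartAt (Fin n → ℂ) x with he
  set p := e.symm y with hp
  set e' := chartAt (Fin n → ℂ) p with he'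
  have hpe : p ∈ e.source := e.map_target hy
  have hpe' : p ∈ e'.source := mem_chart_source _ p
  have hd : ∀ (z z' q : X), q ∈ (chartAt (Fin n → ℂ) z).source →
      q ∈ (chartAt (Fin n → ℂ) z').source →
      DifferentiableAt ℂ (fun w => chartAt (Fin n → ℂ) z' ((chartAt (Fin n → ℂ) z).symm w))
        (chartAt (Fin n → ℂ) z q) := by
    intro z z' q hq hq'
    have h := contDiffWithinAt_ext_coord_change (I := 𝓘(ℂ, Fin n → ℂ)) (n := ω) z' z
      (y := chartAt (Fin n → ℂ) z q) (by simp [hq, hq'])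
    simp only [mfld_simps] at h
    rw [contDiffWithinAt_univ] at h
    exact h.differentiableAt (by simp)
  have hyp : e p = y := e.right_inv hy
  have h1 : DifferentiableAt ℂ (fun w => e' (e.symm w)) y := by
    have h := hd x p p hpe hpe'
    rwa [← he, ← he', hyp] at h
  have h2 : DifferentiableAt ℂ (fun w => e (e'.symm w)) (e' (e.symm y)) := hd p x p hpe' hpe
  have hid : (fun w => e (e'.symm (e' (e.symm w)))) =ᶠ[nhds y] id := by
    have h3 : e.symm ⁻¹' e'.source ∩ e.target ∈ nhds y := by
      refine Filter.inter_mem ?_ (e.open_target.mem_nhds hy)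
      exact (e.symm.continuousAt hy).preimage_mem_nhds (e'.open_source.mem_nhds hpe')
    filter_upwards [h3] with w hw
    rw [e'.left_inv hw.1, e.right_inv hw.2, id]
  have h4 := fderiv_comp y h2 h1
  have h5 : fderiv ℂ ((fun w => e (e'.symm w)) ∘ fun w => e' (e.symm w)) y =
      ContinuousLinearMap.id ℂ _ := by
    rw [← fderiv_id (𝕜 := ℂ) (x := y)]
    exact hid.fderiv_eq
  rw [h5] at h4
  have h6 : Function.LeftInverse (fderiv ℂ (fun w => e (e'.symm w)) (e' (e.symm y)))
      (chartDeriv e y) := fun v => (DFunLike.congr_fun h4 v).symm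
  exact h6.injective

theorem exceedsOn_eventually [IsManifold 𝓘(ℂ, Fin n → ℂ) ω X]
    {A B : X → (Fin n → ℂ) [⋀^Fin 2]→L[ℝ] ℝ} {x₀ : X}
    (hA : ContinuousOn (inChart A (chartAt (Fin n → ℂ) x₀)) (chartAt (Fin n → ℂ) x₀).target)
    (hB : ContinuousOn (inChart B (chartAt (Fin n → ℂ) x₀)) (chartAt (Fin n → ℂ) x₀).target)
    {t : ℝ} {k : ℕ} (h : ExceedsOn (A x₀) (B x₀) t k) :
    ∀ᶠ x in nhds x₀, ExceedsOn (A x) (B x) t k := by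
  set e := chartAt (Fin n → ℂ) x₀ with he
  have hx₀ : x₀ ∈ e.source := mem_chart_source _ x₀
  have htgt : e.target ∈ nhds (e x₀) := e.open_target.mem_nhds (e.map_source hx₀)
  have hiff : ∀ x ∈ e.source, ExceedsOn (inChart A e (e x)) (inChart B e (e x)) t k ↔
      ExceedsOn (A x) (B x) t k := by
    intro x hx
    have h1 : ExceedsOn (inChart A e (e x)) (inChart B e (e x)) t k ↔
        ExceedsOn (A (e.symm (e x))) (B (e.symm (e x))) t k :=
      exceedsOn_comp_iff (A (e.symm (e x))) (B (e.symm (e x))) t k (chartDeriv e (e x))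
      (chartDeriv_injective x₀ (e.map_source hx))
    rwa [e.left_inv hx] at h1
  have h2 := ExceedsOn.eventually (hA.continuousAt htgt) (hB.continuousAt htgt)
    ((hiff x₀ hx₀).2 h)
  filter_upwards [(e.continuousAt hx₀).eventually h2, e.open_source.mem_nhds hx₀] with x hx hxs
  exact (hiff x hxs).1 hx

theorem OneOneForm.continuousOn_inChart (a : OneOneForm n X) (x : X) :
    ContinuousOn (inChart a.val (chartAt (Fin n → ℂ) x)) (chartAt (Fin n → ℂ) x).target :=
  (a.smooth _ (chart_mem_atlas _ x)).continuousOn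

/-- The ordered relative eigenvalues of two `(1,1)`-forms are continuous. -/
theorem continuous_eigenvalue [IsManifold 𝓘(ℂ, Fin n → ℂ) ω X] {α χ : OneOneForm n X}
    {μ : X → Fin n → ℝ} {L : X → (Fin n → ℂ) ≃ₗ[ℂ] (Fin n → ℂ)}
    (D : ∀ x, Diagonalizes (α.val x) (χ.val x) (μ x) (L x)) (k : Fin n) :
    Continuous fun x => μ x k := by
  refine continuous_iff_continuousAt.2 fun x₀ => tendsto_order.2 ⟨fun t ht => ?_, fun t ht => ?_⟩
  · filter_upwards [exceedsOn_eventually (α.continuousOn_inChart x₀) (χ.continuousOn_inChart x₀)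
      ((D x₀).exceedsOn_iff.2 ht)] with x hx
    exact (D x).exceedsOn_iff.1 hx
  · have hneg : ContinuousOn (inChart (fun x => -χ.val x) (chartAt (Fin n → ℂ) x₀))
        (chartAt (Fin n → ℂ) x₀).target := (χ.continuousOn_inChart x₀).neg
    filter_upwards [exceedsOn_eventually (B := fun x => -χ.val x) (α.continuousOn_inChart x₀) hneg
      ((D x₀).exceedsOn_neg_iff.2 ht)] with x hx
    exact (D x).exceedsOn_neg_iff.1 hx

end Chart

/-! ### The branch argument and the final equivalence -/

section Main

variable {n : ℕ} {X : Type*} [TopologicalSpace X] [ChartedSpace (Fin n → ℂ) X]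

theorem OneOneForm.exists_diagonalizes {α : OneOneForm n X} (hα : α.IsKahler)
    (χ : OneOneForm n X) :
    ∃ (μ : X → Fin n → ℝ) (L : X → (Fin n → ℂ) ≃ₗ[ℂ] (Fin n → ℂ)),
      ∀ x, Diagonalizes (α.val x) (χ.val x) (μ x) (L x) := by
  choose μ L D using fun x => DHYM.exists_diagonalizes (α.invariant x) (hα.2 x) (χ.invariant x)
  exact ⟨μ, L, D⟩

theorem phase_eq_arctanSum {α χ : OneOneForm n X} {x : X} {μ : Fin n → ℝ}
    {L : (Fin n → ℂ) ≃ₗ[ℂ] (Fin n → ℂ)} (D : Diagonalizes (α.val x) (χ.val x) μ L) :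
    phase α χ x = arctanSum μ := by
  rw [phase, D.roots, Multiset.map_map]
  rfl

/-- A subsolution may list the eigenvalues in any order; the criterion on partial sums depends only
on their multiset, so the sorted list can be used. -/
theorem bounded_iff_of_roots {α χ : OneOneForm n X} {x : X} {μ : Fin n → ℝ}
    {L : (Fin n → ℂ) ≃ₗ[ℂ] (Fin n → ℂ)} (D : Diagonalizes (α.val x) (χ.val x) μ L) {θ : ℝ}
    (hθ₁ : ((n : ℝ) - 2) * (Real.pi / 2) < θ) (hθ₂ : θ < (n : ℝ) * (Real.pi / 2)) :
    (∃ ν : Fin n → ℝ,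
      relEigenvalues (α.val x) (χ.val x) = Finset.univ.val.map (fun i => (ν i : ℂ)) ∧
      Bornology.IsBounded
        {y : Fin n → ℝ | y ∈ phaseCone n ∧ arctanSum y = θ ∧ ∀ i, 0 < (y - ν) i}) ↔
    ∀ i, θ - Real.pi / 2 < arctanSum μ - Real.arctan (μ i) := by
  constructor
  · rintro ⟨ν, hν, hb⟩ i
    rw [isBounded_phase_iff hθ₁ hθ₂] at hb
    have hmap : Finset.univ.val.map (fun i => (μ i : ℂ)) =
        Finset.univ.val.map (fun i => (ν i : ℂ)) := D.roots.symm.trans hν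
    have hsum : arctanSum μ = arctanSum ν := by
      have h := congrArg (fun s => (Multiset.map (fun z : ℂ => Real.arctan z.re) s).sum) hmap
      simp only [Multiset.map_map] at h
      exact h
    have hmem : (μ i : ℂ) ∈ Finset.univ.val.map (fun i => (ν i : ℂ)) := by
      rw [← hmap]
      exact Multiset.mem_map_of_mem (fun i => (μ i : ℂ)) (Finset.mem_univ i)
    obtain ⟨j, -, hj⟩ := Multiset.mem_map.1 hmem
    rw [hsum, ← Complex.ofReal_injective hj]
    exact hb j
  · exact fun h => ⟨μ, D.roots, (isBounded_phase_iff hθ₁ hθ₂ μ).2 h⟩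

theorem isSubsolution_iff {α χ : OneOneForm n X} {μ : X → Fin n → ℝ}
    {L : X → (Fin n → ℂ) ≃ₗ[ℂ] (Fin n → ℂ)}
    (D : ∀ x, Diagonalizes (α.val x) (χ.val x) (μ x) (L x)) {θ : ℝ}
    (hθ₁ : ((n : ℝ) - 2) * (Real.pi / 2) < θ) (hθ₂ : θ < (n : ℝ) * (Real.pi / 2)) :
    IsSubsolution α (fun _ => θ) χ ↔
      ∀ x i, θ - Real.pi / 2 < arctanSum (μ x) - Real.arctan (μ x i) :=
  forall_congr' fun x => bounded_iff_of_roots (D x) hθ₁ hθ₂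

/-- If `ξ` and `χ` lie in the same class, the phase of `χ` is somewhere at least that of `ξ`. -/
theorem exists_phase_le [CompactSpace X] [Nonempty X] {α ξ₀ ξ χ : OneOneForm n X}
    (hα : α.IsKahler) (hξ : ξ ∈ ξ₀.cohomologyClass) (hχ : χ ∈ ξ₀.cohomologyClass) :
    ∃ x, phase α ξ x ≤ phase α χ x := by
  obtain ⟨u, hu, hξu⟩ := hξ
  obtain ⟨w, hw, hχw⟩ := hχ
  obtain ⟨x, -, hx⟩ := isCompact_univ.exists_isMaxOn Set.univ_nonempty
    (hu.continuous.sub hw.continuous).continuousOn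
  obtain ⟨μ, L, D⟩ := OneOneForm.exists_diagonalizes hα ξ
  obtain ⟨ν, M, D'⟩ := OneOneForm.exists_diagonalizes hα χ
  refine ⟨x, ?_⟩
  rw [phase_eq_arctanSum (D x), phase_eq_arctanSum (D' x)]
  refine Finset.sum_le_sum fun k _ => Real.arctan_mono ((D x).le_of_le (D' x) (fun v => ?_) k)
  rw [hξu, hχw]
  have := ddbar_le_of_isMax hu hw (fun y => hx (Set.mem_univ y)) v
  linarith

/-- The branch argument: under the lower bound on the phase at one point, positivity of the cosines
forces the partial phases into the principal branch. -/
theorem lt_of_cos_pos {m : ℕ} {Y : Type*} [TopologicalSpace Y] [ConnectedSpace Y]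
    {μ : Y → Fin (m + 1) → ℝ} (hμ : ∀ k, Continuous fun x => μ x k) (hanti : ∀ x, Antitone (μ x))
    {θ : ℝ} (hcos : ∀ x i, 0 < Real.cos (arctanSum (μ x) - Real.arctan (μ x i) - θ))
    (hx₀ : ∃ x, θ - Real.pi < arctanSum (μ x)) (x : Y) (i : Fin (m + 1)) :
    θ - Real.pi / 2 < arctanSum (μ x) - Real.arctan (μ x i) := by
  -- Omitting index `0`, the largest eigenvalue, gives the smallest partial sum, so bounding this
  -- one suffices.
  set N : Y → ℝ := fun x => arctanSum (μ x) - Real.arctan (μ x 0) - θ with hN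
  have hNc : Continuous N := by
    have h : ∀ k, Continuous fun x => Real.arctan (μ x k) := fun k =>
      Real.continuous_arctan.comp (hμ k)
    exact ((continuous_finsetSum _ fun k _ => h k).sub (h 0)).sub continuous_const
  obtain ⟨x₀, hx₀⟩ := hx₀
  -- Here `N x₀ > -3π/2`, since the omitted phase is below `π/2`, and the cosine is nonpositive on
  -- `(-3π/2, -π/2]`.
  have h0 : -(Real.pi / 2) < N x₀ := by
    by_contra! hle
    have h1 := Real.arctan_lt_pi_div_two (μ x₀ 0)
    have h2 := hcos x₀ 0
    have h3 : Real.cos (N x₀) = -Real.cos (N x₀ + Real.pi) := by rw [Real.cos_add_pi, neg_neg]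
    have h4 : 0 ≤ Real.cos (N x₀ + Real.pi) :=
      Real.cos_nonneg_of_neg_pi_div_two_le_of_le (by simp only [hN]; linarith) (by linarith)
    have h5 : 0 < Real.cos (N x₀) := h2
    linarith
  -- Otherwise `N` would take the value `-π/2` somewhere by connectedness, and the cosine would
  -- vanish there.
  have hall : -(Real.pi / 2) < N x := by
    by_contra! hle
    obtain ⟨z, hz⟩ := mem_range_of_exists_le_of_exists_ge hNc ⟨x, hle⟩ ⟨x₀, h0.le⟩
    have h1 : 0 < Real.cos (N z) := hcos z 0
    rw [hz, Real.cos_neg, Real.cos_pi_div_two] at h1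
    exact lt_irrefl _ h1
  have hi : Real.arctan (μ x i) ≤ Real.arctan (μ x 0) := Real.arctan_mono (hanti x (Fin.zero_le i))
  simp only [hN] at hall
  linarith

/-- The upper end is automatic: `n - 1` phases sum to at most `(n - 1) π/2`, which is below `θ +
π/2`. -/
theorem cos_pos_of_lt {m : ℕ} {μ : Fin (m + 1) → ℝ} {θ : ℝ}
    (hθ₁ : (((m + 1 : ℕ) : ℝ) - 2) * (Real.pi / 2) < θ) {i : Fin (m + 1)}
    (h : θ - Real.pi / 2 < arctanSum μ - Real.arctan (μ i)) :
    0 < Real.cos (arctanSum μ - Real.arctan (μ i) - θ) := by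
  have h1 := arctanSum_sub_arctan_le μ i
  exact Real.cos_pos_of_mem_Ioo ⟨by linarith, by linarith⟩

/-- Subsolutions are characterized by positivity of `Re (exp (-√-1 θ) (α + √-1 χ)ⁿ⁻¹)`. -/
theorem isSubsolution_iff_isStrictlyPositive {m : ℕ} {X : Type*} [TopologicalSpace X]
    [CompactSpace X] [ConnectedSpace X] [ChartedSpace (Fin (m + 1) → ℂ) X]
    [IsManifold 𝓘(ℂ, Fin (m + 1) → ℂ) ω X] {α ξ₀ ξ χ : OneOneForm (m + 1) X} (hα : α.IsKahler)
    (hξ : ξ ∈ ξ₀.cohomologyClass) (hχ : χ ∈ ξ₀.cohomologyClass) {θ κ : ℝ}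
    (hθ : ∀ x, |phase α ξ x - θ| < Real.pi)
    (hθ₁ : (((m + 1 : ℕ) : ℝ) - 2) * (Real.pi / 2) < θ)
    (hθ₂ : θ < ((m + 1 : ℕ) : ℝ) * (Real.pi / 2)) (hκ : 0 < κ)
    {η : X → (Fin (m + 1) → ℂ) [⋀^Fin (2 * m)]→ₗ[ℝ] ℂ}
    (hη : ∀ x y, η x y = ((κ * (Complex.exp (-(θ * Complex.I)) *
      wedgePow (addI (α.val x) (χ.val x)) m y).re : ℝ) : ℂ)) :
    IsSubsolution α (fun _ => θ) χ ↔ ∀ x, IsStrictlyPositive (η x) := by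
  obtain ⟨μ, L, D⟩ := OneOneForm.exists_diagonalizes hα χ
  have hpos : (∀ x, IsStrictlyPositive (η x)) ↔
      ∀ x i, 0 < Real.cos (arctanSum (μ x) - Real.arctan (μ x i) - θ) :=
    forall_congr' fun x => (D x).isStrictlyPositive_iff hκ (hη x)
  rw [isSubsolution_iff D hθ₁ hθ₂, hpos]
  refine ⟨fun h x i => cos_pos_of_lt hθ₁ (h x i), fun h => ?_⟩
  obtain ⟨x₀, hx₀⟩ := exists_phase_le hα hξ hχ
  refine lt_of_cos_pos (continuous_eigenvalue D) (fun x => (D x).antitone) h ⟨x₀, ?_⟩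
  rw [← phase_eq_arctanSum (D x₀)]
  have := (abs_lt.1 (hθ x₀)).1
  linarith

theorem exp_neg_mul_re (θ : ℝ) (z : ℂ) :
    (Complex.exp (-(θ * Complex.I)) * z).re = Real.cos θ * z.re + Real.sin θ * z.im := by
  rw [← neg_mul, ← Complex.ofReal_neg, Complex.mul_re, Complex.exp_ofReal_mul_I_re,
    Complex.exp_ofReal_mul_I_im, Real.cos_neg, Real.sin_neg]
  ring

/-- For `n` even, the scalar in the positivity condition is a positive multiple of `exp (-√-1 θ)`. -/
theorem exists_scalar_even {k : ℕ} {θ : ℝ} (h₁ : ((k + k : ℕ) : ℝ) * (Real.pi / 2) - Real.pi < θ)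
    (h₂ : θ < ((k + k : ℕ) : ℝ) * (Real.pi / 2)) :
    ∃ κ : ℝ, 0 < κ ∧ ∀ z : ℂ, -(Complex.I ^ (k + k)) * (z.im + (Real.cot θ : ℂ) * z.re) =
      ((κ * (Complex.exp (-(θ * Complex.I)) * z).re : ℝ) : ℂ) := by
  -- With `n = 2k`, the hypotheses place `k π - θ` in `(0, π)`, and its sine is this number. Its
  -- inverse will be `κ`.
  have hs : 0 < (-1) ^ k * -Real.sin θ := by
    have h := Real.sin_pos_of_pos_of_lt_pi (x := (k : ℝ) * Real.pi - θ)
      (by push_cast at h₂; linarith) (by push_cast at h₁; linarith)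
    rw [← Real.sin_neg, ← Real.sin_add_nat_mul_pi]
    rwa [neg_add_eq_sub]
  have hs0 : Real.sin θ ≠ 0 := fun h => by simp [h] at hs
  have hsq : ((-1 : ℝ) ^ k) * (-1) ^ k = 1 := by rw [← mul_pow]; simp
  have hI : Complex.I ^ (k + k) = (((-1 : ℝ) ^ k : ℝ) : ℂ) := by
    rw [← two_mul, pow_mul, Complex.I_sq]; push_cast; rfl
  generalize (-1 : ℝ) ^ k = ε at hs hsq hI
  refine ⟨(ε * -Real.sin θ)⁻¹, inv_pos.2 hs, fun z => ?_⟩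
  rw [hI, exp_neg_mul_re]
  norm_cast
  rw [eq_inv_mul_iff_mul_eq₀ hs.ne', Real.cot_eq_cos_div_sin]
  field_simp
  linear_combination (Real.sin θ * z.im + Real.cos θ * z.re) * hsq

/-- For `n` odd, the scalar in the positivity condition is a positive multiple of `exp (-√-1 θ)`. -/
theorem exists_scalar_odd {k : ℕ} {θ : ℝ} (h₁ : (k : ℝ) * Real.pi - Real.pi / 2 < θ)
    (h₂ : θ < (k : ℝ) * Real.pi + Real.pi / 2) :
    ∃ κ : ℝ, 0 < κ ∧ ∀ z : ℂ, Complex.I ^ (2 * k) * ((Real.tan θ : ℂ) * z.im + z.re) =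
      ((κ * (Complex.exp (-(θ * Complex.I)) * z).re : ℝ) : ℂ) := by
  -- With `n = 2k + 1`, `θ - k π` lies in `(-π/2, π/2)`, and its cosine is this number.
  have hs : 0 < (-1) ^ k * Real.cos θ := by
    have h := Real.cos_pos_of_mem_Ioo (x := θ - (k : ℝ) * Real.pi)
      ⟨by linarith, by linarith⟩
    rwa [Real.cos_sub_nat_mul_pi] at h
  have hs0 : Real.cos θ ≠ 0 := fun h => by simp [h] at hs
  have hsq : ((-1 : ℝ) ^ k) * (-1) ^ k = 1 := by rw [← mul_pow]; simp
  have hI : Complex.I ^ (2 * k) = (((-1 : ℝ) ^ k : ℝ) : ℂ) := by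
    rw [pow_mul, Complex.I_sq]; push_cast; rfl
  generalize (-1 : ℝ) ^ k = ε at hs hsq hI
  refine ⟨(ε * Real.cos θ)⁻¹, inv_pos.2 hs, fun z => ?_⟩
  rw [hI, exp_neg_mul_re]
  norm_cast
  rw [eq_inv_mul_iff_mul_eq₀ hs.ne', Real.tan_eq_sin_div_cos]
  field_simp
  linear_combination (Real.sin θ * z.im + Real.cos θ * z.re) * hsq

end Main

end DHYM

end

theorem proposition8p1 {n : ℕ} (hn : 1 ≤ n)
    {X : Type*} [TopologicalSpace X] [T2Space X] [CompactSpace X] [ConnectedSpace X]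
    [ChartedSpace (Fin n → ℂ) X] [IsManifold 𝓘(ℂ, Fin n → ℂ) ω X]
    (α : DHYM.OneOneForm n X) (hα : α.IsKahler)
    (ξ₀ : DHYM.OneOneForm n X) (hξ₀ : ξ₀.IsClosed)
    (θ : ℝ) (hθ : DHYM.IsLiftedArg α ξ₀ θ)
    (hθ₁ : ((n : ℝ) - 2) * (Real.pi / 2) < θ) (hθ₂ : θ < (n : ℝ) * (Real.pi / 2))
    (χ : DHYM.OneOneForm n X) (hχ : χ ∈ ξ₀.cohomologyClass) :
    (Even n →
      (DHYM.IsSubsolution α (fun _ => θ) χ ↔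
        ∀ x, DHYM.IsStrictlyPositive
          (-(Complex.I ^ n) •
            (DHYM.imForm (DHYM.wedgePow (DHYM.addI (α.val x) (χ.val x)) (n - 1)) +
              (Real.cot θ : ℂ) •
                DHYM.reForm (DHYM.wedgePow (DHYM.addI (α.val x) (χ.val x)) (n - 1)))))) ∧
    (Odd n →
      (DHYM.IsSubsolution α (fun _ => θ) χ ↔
        ∀ x, DHYM.IsStrictlyPositive
          (Complex.I ^ (n - 1) •
            ((Real.tan θ : ℂ) •
                DHYM.imForm (DHYM.wedgePow (DHYM.addI (α.val x) (χ.val x)) (n - 1)) +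
              DHYM.reForm (DHYM.wedgePow (DHYM.addI (α.val x) (χ.val x)) (n - 1)))))) := by
  obtain ⟨-, ξ, hξ, hphase⟩ := hθ
  obtain ⟨m, rfl⟩ : ∃ m, n = m + 1 := ⟨n - 1, by omega⟩
  constructor
  · rintro ⟨k, hk⟩
    have hk' : ((m + 1 : ℕ) : ℝ) = ((k + k : ℕ) : ℝ) := congrArg Nat.cast hk
    obtain ⟨κ, hκ, hz⟩ := DHYM.exists_scalar_even (k := k) (θ := θ)
      (by rw [← hk']; linarith) (by rw [← hk']; exact hθ₂)
    refine DHYM.isSubsolution_iff_isStrictlyPositive hα hξ hχ hphase hθ₁ hθ₂ hκ fun x y => ?_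
    have h := hz (DHYM.wedgePow (DHYM.addI (α.val x) (χ.val x)) m y)
    rw [← hk] at h
    exact h
  · rintro ⟨k, hk⟩
    have hk' : ((m + 1 : ℕ) : ℝ) = 2 * k + 1 := by exact_mod_cast congrArg Nat.cast hk
    have hm : m + 1 - 1 = 2 * k := by omega
    rw [hk'] at hθ₁ hθ₂
    obtain ⟨κ, hκ, hz⟩ := DHYM.exists_scalar_odd (k := k) (θ := θ) (by linarith) (by linarith)
    rw [← hk'] at hθ₁ hθ₂
    refine DHYM.isSubsolution_iff_isStrictlyPositive hα hξ hχ hphase hθ₁ hθ₂ hκ fun x y => ?_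
    have h := hz (DHYM.wedgePow (DHYM.addI (α.val x) (χ.val x)) m y)
    rw [← hm] at h
    exact h
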